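/- Let $d\ge 2$, $\eta=e^{2\pi i/d}$. Consider matrix bifactorisations of $W=x^d$ over $\mathbb{C}[x]$: $\mathbb{Z}_2$-graded $\mathbb{C}[x]$-bimodules with an odd bilinear twisted differential whose square is $x^d\cdot 1-1\cdot x^d$, graded by $R$-charge (the variable has degree $2/d$, the differential degree $1$). Morphisms are even bilinear chain maps of $R$-charge $0$ up to homotopy; tensor products are over the middle variable, with differential $D\otimes 1+1\otimes D$ (Koszul signs). For $S\subset\mathbb{Z}_d$ let $P_S$ have even and odd part $\mathbb{C}[x,y]$, differential $\prod_{j\in S}(x-\eta^jy)$ from odd to even and $(x^d-y^d)/\prod_{j\in S}(x-\eta^jy)$ from even to odd, and even generator of charge $(1-|S|)/d$. Write $P_{m;l}=P_{\{m,\dots,m+l\}}$, $\underline a=P_{a;0}$, $\mathbb{I}=P_{0;0}$. The unitors are $\lambda(f(x,y)\otimes p)=f(x,x).p$ and $\rho(p\otimes f(x,y))=p.f(y,y)$, both zero on the odd summand of $\mathbb I$. Let ${}_a(P_S)_b$ be $P_S$ with $x$ acting on the left as $\eta^{-a}x$ and on the right as $\eta^{b}y$, and let $s_{a,b}\colon P_{S-a-b}\to{}_a(P_S)_b$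 be the isomorphism $f(x,y)\mapsto f(\eta^{-a}x,\eta^by)$, multiplied by $\eta^{-|S|a}$ on the odd part. Define $$\psi^L_{a;S}\colon \underline aP_S\xrightarrow{s_{0,-a}\otimes 1}\mathbb I_{-a}P_S=\mathbb I\,{}_{-a}(P_S)\xrightarrow{1\otimes s_{-a,0}^{-1}}\mathbb IP_{S+a}\xrightarrow{\lambda}P_{S+a},$$ $$\psi^R_{S;a}\colon P_S\underline a\xrightarrow{1\otimes s_{-a,0}}P_S\,{}_{-a}\mathbb I=(P_S)_{-a}\mathbb I\xrightarrow{s_{0,-a}^{-1}\otimes 1}P_{S+a}\mathbb I\xrightarrow{\rho}P_{S+a},$$ and $\mathrm{ev}_a=\psi^L_{-a;\{a\}}\colon\underline{-a}\,\underline a\to\mathbb I$. Then all $\psi^L_{a;S}$ and $\psi^R_{S;a}$ are isomorphisms. Let $\kappa^L_{a;S}\colon P_S\to\underline a\,P_S\,\underline{-a}$ be the composite of $(\psi^R_{S+a;-a})^{-1}$ and $(\psi^L_{a;S})^{-1}\otimes1$, and let $\kappa^R_{a;S}\colon P_S\to\underline a\,P_S\,\underline{-a}$ be the composite of $(\psi^L_{a;S-a})^{-1}$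 and $1\otimes(\psi^R_{S;-a})^{-1}$. For all $a\in\mathbb{Z}$, $m,m',m''\in\mathbb{Z}_d$, $l,l',l''\in\{0,\dots,d-2\}$ and every morphism $\varphi\colon P_{m;l}\to P_{m';l'}P_{m'';l''}$, $$(1_{\underline a}\otimes\varphi\otimes1_{\underline{-a}})\circ\kappa^L_{a;(m;l)}=\eta^{\frac a2(l-l'-l'')}\,(1\otimes\mathrm{ev}_a\otimes1)\circ(\kappa^L_{a;(m';l')}\otimes\kappa^R_{a;(m'';l'')})\circ\varphi$$ as morphisms $P_{m;l}\to\underline a\,P_{m';l'}P_{m'';l''}\,\underline{-a}$ (associators and unitors suppressed), where $\eta^{t}=e^{2\pi i t/d}$. -/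

import Mathlib

open CategoryTheory
open scoped TensorProduct

namespace LandauGinzburg

noncomputable section

/-! ### Graded matrix bifactorisations of `x ^ d` -/

/-- A graded (matrix) bifactorisation of `W = x ^ d` over `R = ℂ[x]`.

The underlying `R`-`R`-bimodule is a complex vector space with two commuting endomorphisms, the
left action `xl` and the right action `xr` of the variable `x`. The `ℤ/2`-grading is given by its
parity operator `par` (`+1` on the even part, `-1` on the odd part), and the grading by `R`-charge
(in which `x` has degree `2 / d`, `W` has degree `2` and the twisted differential has degree `1`)
by the diagonalisable degree operator `chg`, which is multiplication by `q` on the part of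
degree `q`. The twisted differential is `diff`.

Freeness and finite rank are not asked for, because a tensor product over the middle variable
is not of finite rank. This does not change the morphisms between given bifactorisations. -/
structure Bifact (d : ℕ) where
  carrier : Type
  [addCommGroup : AddCommGroup carrier]
  [module : Module ℂ carrier]
  /-- left multiplication by the variable -/
  xl : Module.End ℂ carrier
  /-- right multiplication by the variable -/
  xr : Module.End ℂ carrier
  /-- parity operator -/
  par : Module.End ℂ carrier
  /-- degree operator of the `R`-charge -/
  chg : Module.End ℂ carrier
  /-- twisted differential -/
  diff : Module.End ℂ carrier
  xl_xr : ∀ m, xl (xr m) = xr (xl m)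
  par_par : ∀ m, par (par m) = m
  par_xl : ∀ m, par (xl m) = xl (par m)
  par_xr : ∀ m, par (xr m) = xr (par m)
  chg_xl : ∀ m, chg (xl m) = xl (chg m) + (2 / d : ℂ) • xl m
  chg_xr : ∀ m, chg (xr m) = xr (chg m) + (2 / d : ℂ) • xr m
  chg_par : ∀ m, chg (par m) = par (chg m)
  chg_diagonalisable : ⨆ q : ℂ, chg.eigenspace q = ⊤
  diff_xl : ∀ m, diff (xl m) = xl (diff m)
  diff_xr : ∀ m, diff (xr m) = xr (diff m)
  diff_par : ∀ m, diff (par m) = -par (diff m)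
  chg_diff : ∀ m, chg (diff m) = diff (chg m) + diff m
  diff_diff : ∀ m, diff (diff m) = (xl ^ d) m - (xr ^ d) m

variable {d : ℕ}

instance : CoeSort (Bifact d) Type := ⟨Bifact.carrier⟩
instance (M : Bifact d) : AddCommGroup M := M.addCommGroup
instance (M : Bifact d) : Module ℂ M := M.module

/-! ### The homotopy category -/

/-- Even, bilinear, charge preserving maps `f` with `δ f = diff ∘ f - f ∘ diff = 0`. -/
def cycles (M N : Bifact d) : Submodule ℂ (M →ₗ[ℂ] N) where
  carrier := {f | (∀ m, f (M.xl m) = N.xl (f m)) ∧ (∀ m, f (M.xr m) = N.xr (f m)) ∧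
    (∀ m, f (M.par m) = N.par (f m)) ∧ (∀ m, f (M.chg m) = N.chg (f m)) ∧
    (∀ m, f (M.diff m) = N.diff (f m))}
  zero_mem' := by simp
  add_mem' := by
    rintro f g ⟨h1, h2, h3, h4, h5⟩ ⟨k1, k2, k3, k4, k5⟩
    refine ⟨?_, ?_, ?_, ?_, ?_⟩ <;> intro m <;> simp_all
  smul_mem' := by
    rintro c f ⟨h1, h2, h3, h4, h5⟩
    refine ⟨?_, ?_, ?_, ?_, ?_⟩ <;> intro m <;> simp_all

/-- The maps `δ h = diff ∘ h + h ∘ diff` with `h` odd, bilinear and of charge `-1`. -/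
def boundaries (M N : Bifact d) : Submodule ℂ (M →ₗ[ℂ] N) where
  carrier := {f | ∃ h : M →ₗ[ℂ] N,
    (∀ m, h (M.xl m) = N.xl (h m)) ∧ (∀ m, h (M.xr m) = N.xr (h m)) ∧
    (∀ m, h (M.par m) = -N.par (h m)) ∧ (∀ m, N.chg (h m) = h (M.chg m) - h m) ∧
    (∀ m, f m = N.diff (h m) + h (M.diff m))}
  zero_mem' := ⟨0, by simp⟩
  add_mem' := by
    rintro f g ⟨h, h1, h2, h3, h4, h5⟩ ⟨k, k1, k2, k3, k4, k5⟩
    refine ⟨h + k, ?_, ?_, ?_, ?_, ?_⟩ <;> intro m <;> simp_all <;> abel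
  smul_mem' := by
    rintro c f ⟨h, h1, h2, h3, h4, h5⟩
    refine ⟨c • h, ?_, ?_, ?_, ?_, ?_⟩ <;> intro m <;> simp_all [smul_sub]

/-- Morphisms of the homotopy category: the degree zero homology of the morphism complex. -/
abbrev HMFHom (M N : Bifact d) : Type :=
  cycles M N ⧸ (boundaries M N).comap (cycles M N).subtype

/-- The homotopy class of a chain map. -/
def homClass {M N : Bifact d} (f : cycles M N) : HMFHom M N := Submodule.Quotient.mk f

theorem homClass_eq {M N : Bifact d} {f g : cycles M N} :
    homClass f = homClass g ↔ (f - g : M →ₗ[ℂ] N) ∈ boundaries M N :=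
  Submodule.Quotient.eq _

/-- Composition of chain maps (in diagrammatic order). -/
def cyclesComp {M N P : Bifact d} (f : cycles M N) (g : cycles N P) : cycles M P :=
  ⟨g.1 ∘ₗ f.1, by
    obtain ⟨f, h1, h2, h3, h4, h5⟩ := f
    obtain ⟨g, k1, k2, k3, k4, k5⟩ := g
    refine ⟨?_, ?_, ?_, ?_, ?_⟩ <;> intro m <;> simp_all⟩

/-- The homotopy category of graded bifactorisations of `x ^ d`. -/
instance : Category (Bifact d) where
  Hom M N := HMFHom M N
  id M := homClass ⟨LinearMap.id, by refine ⟨?_, ?_, ?_, ?_, ?_⟩ <;> simp⟩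
  comp {M N P} := Quotient.map₂ cyclesComp (by
    rintro f f' hf g g' hg
    obtain ⟨h, h1, h2, h3, h4, h5⟩ := homClass_eq.1 (Quotient.sound hf)
    obtain ⟨k, k1, k2, k3, k4, k5⟩ := homClass_eq.1 (Quotient.sound hg)
    refine Quotient.exact (homClass_eq.2 ⟨g.1 ∘ₗ h + k ∘ₗ f'.1, ?_⟩)
    obtain ⟨f, f1, f2, f3, f4, f5⟩ := f
    obtain ⟨f', f1', f2', f3', f4', f5'⟩ := f'
    obtain ⟨g, g1, g2, g3, g4, g5⟩ := g
    obtain ⟨g', g1', g2', g3', g4', g5'⟩ := g'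
    refine ⟨?_, ?_, ?_, ?_, ?_⟩ <;> intro m
    · simp_all
    · simp_all
    · simp_all; abel
    · simp [← g4, k4, h4, f4']; abel
    · have e1 := congrArg g (h5 m)
      have e2 := k5 (f' m)
      simp only [LinearMap.sub_apply, map_add, map_sub, g5, ← f5'] at e1 e2
      simp only [cyclesComp, LinearMap.sub_apply, LinearMap.comp_apply, LinearMap.add_apply,
        map_add]
      calc g (f m) - g' (f' m) = (g (f m) - g (f' m)) + (g (f' m) - g' (f' m)) := by abel
        _ = _ := by rw [e1, e2]; abel)
  id_comp := by rintro M N ⟨f⟩; rfl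
  comp_id := by rintro M N ⟨f⟩; rfl
  assoc := by rintro M N P Q ⟨f⟩ ⟨g⟩ ⟨h⟩; rfl

instance (M N : Bifact d) : AddCommGroup (M ⟶ N) := inferInstanceAs (AddCommGroup (HMFHom M N))
instance (M N : Bifact d) : Module ℂ (M ⟶ N) := inferInstanceAs (Module ℂ (HMFHom M N))

/-- The isomorphism in the homotopy category given by a bijective chain map `f`, with inverse
map `g`. -/
def isoMk {M N : Bifact d} (f : cycles M N) (g : N →ₗ[ℂ] M) (h1 : ∀ m, g (f.1 m) = m)
    (h2 : ∀ n, f.1 (g n) = n) : M ≅ N where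
  hom := homClass f
  inv := homClass ⟨g, by
    obtain ⟨f, f1, f2, f3, f4, f5⟩ := f
    refine ⟨?_, ?_, ?_, ?_, ?_⟩ <;> intro n
    · conv_lhs => rw [← h2 n, ← f1, h1]
    · conv_lhs => rw [← h2 n, ← f2, h1]
    · conv_lhs => rw [← h2 n, ← f3, h1]
    · conv_lhs => rw [← h2 n, ← f4, h1]
    · conv_lhs => rw [← h2 n, ← f5, h1]⟩
  hom_inv_id := congrArg homClass (Subtype.ext (LinearMap.ext h1))
  inv_hom_id := congrArg homClass (Subtype.ext (LinearMap.ext h2))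

/-! ### The tensor product over the middle variable -/

/-- The relations `m x ⊗ n = m ⊗ x n`. -/
def balanced (M N : Bifact d) : Submodule ℂ (M ⊗[ℂ] N) :=
  LinearMap.range (TensorProduct.map M.xr LinearMap.id - TensorProduct.map LinearMap.id N.xl)

/-- The vector space `M ⊗ N` over `ℂ[x]`, using the right action on `M` and the left one on `N`. -/
abbrev BalTensor (M N : Bifact d) : Type := (M ⊗[ℂ] N) ⧸ balanced M N

/-- Pure tensors. -/
def pureTensor (M N : Bifact d) : M →ₗ[ℂ] N →ₗ[ℂ] BalTensor M N :=
  (TensorProduct.mk ℂ M N).compr₂ (balanced M N).mkQ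

theorem pureTensor_balanced (M N : Bifact d) (m : M) (n : N) :
    pureTensor M N (M.xr m) n = pureTensor M N m (N.xl n) :=
  (Submodule.Quotient.eq _).2 ⟨m ⊗ₜ n, by simp⟩

/-- The universal property of the tensor product. -/
def balLift {M N : Bifact d} {Q : Type*} [AddCommGroup Q] [Module ℂ Q] (B : M →ₗ[ℂ] N →ₗ[ℂ] Q)
    (hB : ∀ m n, B (M.xr m) n = B m (N.xl n)) : BalTensor M N →ₗ[ℂ] Q :=
  (balanced M N).liftQ (TensorProduct.lift B) (by
    rintro _ ⟨t, rfl⟩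
    rw [LinearMap.mem_ker]
    induction t with
    | zero => simp
    | tmul m n => simp [hB]
    | add s t hs ht => rw [map_add, map_add, hs, ht, add_zero])

@[simp] theorem balLift_pure {M N : Bifact d} {Q : Type*} [AddCommGroup Q] [Module ℂ Q]
    (B : M →ₗ[ℂ] N →ₗ[ℂ] Q) (hB : ∀ m n, B (M.xr m) n = B m (N.xl n)) (m : M) (n : N) :
    balLift B hB (pureTensor M N m n) = B m n := by
  simp [balLift, pureTensor]

theorem bal_induction {M N : Bifact d} {p : BalTensor M N → Prop}
    (pure : ∀ m n, p (pureTensor M N m n)) (add : ∀ s t, p s → p t → p (s + t)) (t) : p t := by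
  obtain ⟨t, rfl⟩ := Submodule.Quotient.mk_surjective _ t
  induction t with
  | zero => simpa using pure 0 0
  | tmul m n => exact pure m n
  | add s t hs ht => exact add _ _ hs ht

/-- `A ⊗ B` for maps `A` and `B` that are linear over the middle variable. -/
def balMap {M N M' N' : Bifact d} (A : M →ₗ[ℂ] M') (B : N →ₗ[ℂ] N')
    (hA : ∀ m, A (M.xr m) = M'.xr (A m)) (hB : ∀ n, B (N.xl n) = N'.xl (B n)) :
    BalTensor M N →ₗ[ℂ] BalTensor M' N' :=
  balLift ((pureTensor M' N').compl₁₂ A B) (by simp [hA, hB, pureTensor_balanced])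

@[simp] theorem balMap_pure {M N M' N' : Bifact d} (A : M →ₗ[ℂ] M') (B : N →ₗ[ℂ] N')
    (hA : ∀ m, A (M.xr m) = M'.xr (A m)) (hB : ∀ n, B (N.xl n) = N'.xl (B n)) (m : M) (n : N) :
    balMap A B hA hB (pureTensor M N m n) = pureTensor M' N' (A m) (B n) := by
  simp [balMap]

/-- The degree operator of a tensor product: degrees add up. -/
def tensorChg (M N : Bifact d) : Module.End ℂ (BalTensor M N) :=
  balLift ((pureTensor M N) ∘ₗ M.chg + (pureTensor M N).compl₂ N.chg) (by
    intro m n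
    simp [M.chg_xr, N.chg_xl, pureTensor_balanced]
    abel)

/-- The twisted differential `diff ⊗ 1 + 1 ⊗ diff`, with the Koszul sign
`(1 ⊗ diff) (m ⊗ n) = (-1) ^ |m| m ⊗ diff n`. -/
def tensorDiff (M N : Bifact d) : Module.End ℂ (BalTensor M N) :=
  balMap M.diff LinearMap.id M.diff_xr (fun _ => rfl) + balMap M.par N.diff M.par_xr N.diff_xl

@[simp] theorem tensorChg_pure (M N : Bifact d) (m : M) (n : N) :
    tensorChg M N (pureTensor M N m n) =
      pureTensor M N (M.chg m) n + pureTensor M N m (N.chg n) := by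
  simp [tensorChg]

@[simp] theorem tensorDiff_pure (M N : Bifact d) (m : M) (n : N) :
    tensorDiff M N (pureTensor M N m n) =
      pureTensor M N (M.diff m) n + pureTensor M N (M.par m) (N.diff n) := by
  simp [tensorDiff]

theorem pureTensor_balanced_pow (M N : Bifact d) (k : ℕ) (m : M) (n : N) :
    pureTensor M N ((M.xr ^ k) m) n = pureTensor M N m ((N.xl ^ k) n) := by
  induction k generalizing m n with
  | zero => rfl
  | succ k ih => rw [pow_succ', Module.End.mul_apply, pureTensor_balanced, ih, pow_succ,
      Module.End.mul_apply]

theorem balMap_xl_pow (M N : Bifact d) (k : ℕ) (m : M) (n : N) :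
    ((balMap M.xl LinearMap.id M.xl_xr (fun _ => rfl) : Module.End ℂ (BalTensor M N)) ^ k)
      (pureTensor M N m n) = pureTensor M N ((M.xl ^ k) m) n := by
  induction k generalizing m with
  | zero => rfl
  | succ k ih => simp [pow_succ, ih]

theorem balMap_xr_pow (M N : Bifact d) (k : ℕ) (m : M) (n : N) :
    ((balMap LinearMap.id N.xr (fun _ => rfl) (fun n => (N.xl_xr n).symm) :
      Module.End ℂ (BalTensor M N)) ^ k)
      (pureTensor M N m n) = pureTensor M N m ((N.xr ^ k) n) := by
  induction k generalizing n with
  | zero => rfl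
  | succ k ih => simp [pow_succ, ih]

theorem tensorChg_diagonalisable (M N : Bifact d) :
    ⨆ q : ℂ, (tensorChg M N).eigenspace q = ⊤ := by
  rw [eq_top_iff]
  rintro t -
  induction t using bal_induction with
  | add s t hs ht => exact add_mem hs ht
  | pure m n =>
    have hm : m ∈ ⨆ q : ℂ, M.chg.eigenspace q := by rw [M.chg_diagonalisable]; trivial
    have hn : n ∈ ⨆ q : ℂ, N.chg.eigenspace q := by rw [N.chg_diagonalisable]; trivial
    induction hm using Submodule.iSup_induction' with
    | zero => simp
    | add a b _ _ ha hb => rw [map_add]; exact add_mem ha hb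
    | mem p m hm =>
      induction hn using Submodule.iSup_induction' with
      | zero => simp
      | add a b _ _ ha hb => rw [map_add]; exact add_mem ha hb
      | mem q n hn =>
        refine Submodule.mem_iSup_of_mem (p + q) ?_
        rw [Module.End.mem_eigenspace_iff] at hm hn ⊢
        simp [hm, hn, add_smul]

/-- The tensor product of bifactorisations. -/
def tensorObj (M N : Bifact d) : Bifact d where
  carrier := BalTensor M N
  xl := balMap M.xl LinearMap.id M.xl_xr (fun _ => rfl)
  xr := balMap LinearMap.id N.xr (fun _ => rfl) (fun n => (N.xl_xr n).symm)
  par := balMap M.par N.par M.par_xr N.par_xl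
  chg := tensorChg M N
  diff := tensorDiff M N
  xl_xr t := by induction t using bal_induction <;> simp_all
  par_par t := by induction t using bal_induction <;> simp_all [M.par_par, N.par_par]
  par_xl t := by induction t using bal_induction <;> simp_all [M.par_xl]
  par_xr t := by induction t using bal_induction <;> simp_all [N.par_xr]
  chg_xl t := by
    induction t using bal_induction with
    | pure m n => simp [M.chg_xl]; abel
    | add s t hs ht => simp [hs, ht]; abel
  chg_xr t := by
    induction t using bal_induction with
    | pure m n => simp [N.chg_xr]; abel
    | add s t hs ht => simp [hs, ht]; abel
  chg_par t := by
    induction t using bal_induction with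
    | pure m n => simp [N.chg_par, M.chg_par]
    | add s t hs ht => simp [hs, ht]
  chg_diagonalisable := tensorChg_diagonalisable M N
  diff_xl t := by
    induction t using bal_induction with
    | pure m n => simp [M.diff_xl, M.par_xl]
    | add s t hs ht => simp [hs, ht]
  diff_xr t := by
    induction t using bal_induction with
    | pure m n => simp [N.diff_xr]
    | add s t hs ht => simp [hs, ht]
  diff_par t := by
    induction t using bal_induction with
    | pure m n => simp [M.diff_par, N.diff_par, M.par_par]; abel
    | add s t hs ht => simp [hs, ht]; abel
  chg_diff t := by
    induction t using bal_induction with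
    | pure m n => simp [M.chg_diff, N.chg_diff, M.chg_par]; abel
    | add s t hs ht => simp [hs, ht]; abel
  diff_diff t := by
    induction t using bal_induction with
    | pure m n =>
      simp [M.diff_diff, N.diff_diff, M.diff_par, M.par_par, balMap_xl_pow, balMap_xr_pow,
        pureTensor_balanced_pow]
    | add s t hs ht => simp only [map_add, hs, ht]; abel

infixr:70 " ⊙ " => tensorObj

/-- The pure tensor of `m` and `n` in `M ⊙ N`. -/
def tmul {M N : Bifact d} (m : M) (n : N) : (M ⊙ N : Bifact d) := pureTensor M N m n

infixl:75 " ⊗ₚ " => tmul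

section tmul

variable {M N M' N' : Bifact d}

@[simp] theorem add_tmul (m m' : M) (n : N) : (m + m') ⊗ₚ n = m ⊗ₚ n + m' ⊗ₚ n :=
  congrArg (fun f => f n) (map_add (pureTensor M N) m m')
@[simp] theorem tmul_add (m : M) (n n' : N) : m ⊗ₚ (n + n') = m ⊗ₚ n + m ⊗ₚ n' :=
  map_add (pureTensor M N m) n n'
@[simp] theorem sub_tmul (m m' : M) (n : N) : (m - m') ⊗ₚ n = m ⊗ₚ n - m' ⊗ₚ n :=
  congrArg (fun f => f n) (map_sub (pureTensor M N) m m')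
@[simp] theorem tmul_sub (m : M) (n n' : N) : m ⊗ₚ (n - n') = m ⊗ₚ n - m ⊗ₚ n' :=
  map_sub (pureTensor M N m) n n'
@[simp] theorem neg_tmul (m : M) (n : N) : (-m) ⊗ₚ n = -(m ⊗ₚ n) :=
  congrArg (fun f => f n) (map_neg (pureTensor M N) m)
@[simp] theorem tmul_neg (m : M) (n : N) : m ⊗ₚ (-n) = -(m ⊗ₚ n) :=
  map_neg (pureTensor M N m) n
@[simp] theorem smul_tmul (c : ℂ) (m : M) (n : N) : (c • m) ⊗ₚ n = c • (m ⊗ₚ n) :=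
  congrArg (fun f => f n) (map_smul (pureTensor M N) c m)
@[simp] theorem tmul_smul (c : ℂ) (m : M) (n : N) : m ⊗ₚ (c • n) = c • (m ⊗ₚ n) :=
  map_smul (pureTensor M N m) c n
theorem xr_tmul (m : M) (n : N) : M.xr m ⊗ₚ n = m ⊗ₚ N.xl n := pureTensor_balanced M N m n
@[simp] theorem xl_tmul (m : M) (n : N) : (M ⊙ N).xl (m ⊗ₚ n) = M.xl m ⊗ₚ n :=
  balMap_pure (M' := M) (N' := N) M.xl LinearMap.id M.xl_xr (fun _ => rfl) m n
@[simp] theorem tmul_xr (m : M) (n : N) : (M ⊙ N).xr (m ⊗ₚ n) = m ⊗ₚ N.xr n :=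
  balMap_pure (M' := M) (N' := N) LinearMap.id N.xr (fun _ => rfl) (fun n => (N.xl_xr n).symm) m n
@[simp] theorem par_tmul (m : M) (n : N) : (M ⊙ N).par (m ⊗ₚ n) = M.par m ⊗ₚ N.par n :=
  balMap_pure (M' := M) (N' := N) M.par N.par M.par_xr N.par_xl m n
@[simp] theorem chg_tmul (m : M) (n : N) :
    (M ⊙ N).chg (m ⊗ₚ n) = M.chg m ⊗ₚ n + m ⊗ₚ N.chg n := tensorChg_pure M N m n
@[simp] theorem diff_tmul (m : M) (n : N) :
    (M ⊙ N).diff (m ⊗ₚ n) = M.diff m ⊗ₚ n + M.par m ⊗ₚ N.diff n := tensorDiff_pure M N m n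

theorem tensor_induction {p : (M ⊙ N : Bifact d) → Prop} (t : (M ⊙ N : Bifact d))
    (tmul : ∀ m n, p (m ⊗ₚ n)) (add : ∀ s t, p s → p t → p (s + t)) : p t :=
  bal_induction (p := p) tmul add t

/-- Linear maps out of a tensor product. -/
def tensorLift {Q : Type*} [AddCommGroup Q] [Module ℂ Q] (B : M →ₗ[ℂ] N →ₗ[ℂ] Q)
    (hB : ∀ m n, B (M.xr m) n = B m (N.xl n)) : (M ⊙ N : Bifact d) →ₗ[ℂ] Q := balLift B hB

@[simp] theorem tensorLift_tmul {Q : Type*} [AddCommGroup Q] [Module ℂ Q]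
    (B : M →ₗ[ℂ] N →ₗ[ℂ] Q) (hB : ∀ m n, B (M.xr m) n = B m (N.xl n)) (m : M) (n : N) :
    tensorLift B hB (m ⊗ₚ n) = B m n := balLift_pure B hB m n

/-- `A ⊗ B` as a linear map. -/
def tensorMap (A : M →ₗ[ℂ] M') (B : N →ₗ[ℂ] N')
    (hA : ∀ m, A (M.xr m) = M'.xr (A m)) (hB : ∀ n, B (N.xl n) = N'.xl (B n)) :
    (M ⊙ N : Bifact d) →ₗ[ℂ] (M' ⊙ N' : Bifact d) := balMap A B hA hB

@[simp] theorem tensorMap_tmul (A : M →ₗ[ℂ] M') (B : N →ₗ[ℂ] N')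
    (hA : ∀ m, A (M.xr m) = M'.xr (A m)) (hB : ∀ n, B (N.xl n) = N'.xl (B n)) (m : M) (n : N) :
    tensorMap A B hA hB (m ⊗ₚ n) = A m ⊗ₚ B n := balMap_pure A B hA hB m n

/-- `m ↦ n ↦ m ⊗ n` as a bilinear map. -/
def tmulL (M N : Bifact d) : M →ₗ[ℂ] N →ₗ[ℂ] (M ⊙ N : Bifact d) :=
  LinearMap.mk₂ ℂ tmul add_tmul smul_tmul tmul_add tmul_smul

@[simp] theorem tmulL_apply (m : M) (n : N) : tmulL M N m n = m ⊗ₚ n := rfl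

end tmul

/-- The tensor product of chain maps. -/
def cyclesTensor {M M' N N' : Bifact d} (f : cycles M M') (g : cycles N N') :
    cycles (M ⊙ N) (M' ⊙ N') :=
  ⟨tensorMap f.1 g.1 f.2.2.1 g.2.1, by
    obtain ⟨f, f1, f2, f3, f4, f5⟩ := f
    obtain ⟨g, g1, g2, g3, g4, g5⟩ := g
    refine ⟨?_, ?_, ?_, ?_, ?_⟩ <;> intro t <;>
      induction t using tensor_induction with
      | tmul m n => simp [f1, f3, f4, f5, g2, g3, g4, g5]
      | add s t hs ht => simp only [map_add, hs, ht]⟩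

/-- The tensor product of morphisms in the homotopy category. -/
def tensorHom {M M' N N' : Bifact d} : (M ⟶ M') → (N ⟶ N') → (M ⊙ N ⟶ M' ⊙ N') :=
  Quotient.map₂ cyclesTensor (by
    rintro f f' hf g g' hg
    obtain ⟨h, h1, h2, h3, h4, h5⟩ := homClass_eq.1 (Quotient.sound hf)
    obtain ⟨k, k1, k2, k3, k4, k5⟩ := homClass_eq.1 (Quotient.sound hg)
    obtain ⟨f, f1, f2, f3, f4, f5⟩ := f
    obtain ⟨f', f1', f2', f3', f4', f5'⟩ := f'
    obtain ⟨g, g1, g2, g3, g4, g5⟩ := g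
    obtain ⟨g', g1', g2', g3', g4', g5'⟩ := g'
    refine Quotient.exact (homClass_eq.2 ⟨tensorMap h g h2 g1 +
      tensorMap (M'.par ∘ₗ f') k (by simp [f2', M'.par_xr]) k1, ?_⟩)
    simp only [LinearMap.sub_apply] at h5 k5
    refine ⟨?_, ?_, ?_, ?_, ?_⟩ <;> intro t <;> induction t using tensor_induction with
      | add s t hs ht => first
        | simp only [map_add, neg_add, hs, ht]; done
        | simp only [map_add, hs, ht]; abel
      | tmul m n => ?_
    · simp [h1, f1', M'.par_xl]
    · simp [g2, k2]
    · simp [h3, g3, f3', k3]; abel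
    · simp [h4, g4, ← f4', k4, M'.chg_par]; abel
    · have e3 : f m ⊗ₚ g n - f' m ⊗ₚ g' n =
          (M'.diff (h m) ⊗ₚ g n + h (M.diff m) ⊗ₚ g n) +
          (f' m ⊗ₚ N'.diff (k n) + f' m ⊗ₚ k (N.diff n)) := by
        rw [← add_tmul, ← tmul_add, ← h5, ← k5]
        simp
      simp [cyclesTensor, e3, f3', M'.par_par, h3, g5, f5', M'.diff_par]
      abel)

infixr:70 " ⊙ₘ " => tensorHom

/-- The associator. -/
def associator (M N P : Bifact d) : (M ⊙ N) ⊙ P ≅ M ⊙ (N ⊙ P) :=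
  isoMk
    ⟨tensorLift (tensorLift ((LinearMap.llcomp ℂ P (N ⊙ P) (M ⊙ (N ⊙ P))).compl₁₂
        (tmulL M (N ⊙ P)) (tmulL N P))
        (fun m n => by ext p; simp [xr_tmul]))
        (fun t p => by
          induction t using tensor_induction with
          | tmul m n => simp [xr_tmul]
          | add s t hs ht => simp only [map_add, LinearMap.add_apply, hs, ht]), by
      refine ⟨?_, ?_, ?_, ?_, ?_⟩ <;> intro t <;> induction t using tensor_induction with
        | add s t hs ht => simp only [map_add, hs, ht]
        | tmul t p => induction t using tensor_induction with
          | add s t hs ht =>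
            simp only [add_tmul, map_add, hs, ht]
          | tmul m n => simp; try abel⟩
    (tensorLift (tensorLift (((LinearMap.llcomp ℂ M (M ⊙ N) ((M ⊙ N) ⊙ P)).compl₁₂
        (tmulL (M ⊙ N) P).flip (tmulL M N).flip).flip)
        (fun n p => by ext m; simp [← xr_tmul])).flip
        (fun m t => by
          induction t using tensor_induction with
          | tmul n p => simp [xr_tmul]
          | add s t hs ht => simp only [map_add, hs, ht]))
    (fun t => by
      induction t using tensor_induction with
      | add s t hs ht => simp only [map_add, hs, ht]
      | tmul t p => induction t using tensor_induction with
        | add s t hs ht => simp only [add_tmul, map_add, hs, ht]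
        | tmul m n => simp)
    (fun t => by
      induction t using tensor_induction with
      | add s t hs ht => simp only [map_add, hs, ht]
      | tmul m t => induction t using tensor_induction with
        | add s t hs ht => simp only [tmul_add, map_add, hs, ht]
        | tmul n p => simp)

/-! ### Permutation type bifactorisations -/

section perm


/-- `ℂ[x, y]`, where `x` is `X 0` and `y` is `X 1`. -/
abbrev Poly : Type := MvPolynomial (Fin 2) ℂ

/-- The Euler derivation `x ∂/∂x + y ∂/∂y`, which is multiplication by `n` on the homogeneous
polynomials of degree `n`. -/
def euler : Derivation ℂ Poly Poly := MvPolynomial.mkDerivation ℂ MvPolynomial.X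

@[simp] theorem euler_X (i : Fin 2) : euler (MvPolynomial.X i) = MvPolynomial.X i :=
  MvPolynomial.mkDerivation_X _ _ _

@[simp] theorem euler_C (c : ℂ) : euler (MvPolynomial.C c) = 0 :=
  MvPolynomial.derivation_C _ _

theorem euler_monomial (u : Fin 2 →₀ ℕ) (c : ℂ) :
    euler (MvPolynomial.monomial u c) = ((u 0 + u 1 : ℕ) : ℂ) • MvPolynomial.monomial u c := by
  rw [euler, MvPolynomial.mkDerivation_monomial, Finsupp.sum_fintype _ _ (by simp),
    Fin.sum_univ_two, MvPolynomial.smul_monomial]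
  have key : ∀ i : Fin 2, (MvPolynomial.monomial (u - Finsupp.single i 1) (u i : ℂ)) •
      (MvPolynomial.X i : Poly) = MvPolynomial.monomial u (u i : ℂ) := by
    intro i
    rw [smul_eq_mul, MvPolynomial.X, MvPolynomial.monomial_mul, mul_one]
    by_cases h : u i = 0
    · simp [h]
    · rw [tsub_add_cancel_of_le (Finsupp.single_le_iff.2 (Nat.one_le_iff_ne_zero.2 h))]
  rw [key, key, ← map_add, MvPolynomial.smul_monomial]
  congr 1
  simp [mul_comm]

/-- `f (x, y) ↦ f (x, x)`. -/
def diagonal : Poly →ₐ[ℂ] Polynomial ℂ := MvPolynomial.aeval fun _ => Polynomial.X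

/-- The left action of `f (x, x)` on `M`. -/
def actL (M : Bifact d) : Poly →ₗ[ℂ] Module.End ℂ M :=
  ((Polynomial.aeval M.xl).comp diagonal).toLinearMap

/-- The right action of `f (x, x)` on `M`. -/
def actR (M : Bifact d) : Poly →ₗ[ℂ] Module.End ℂ M :=
  ((Polynomial.aeval M.xr).comp diagonal).toLinearMap

@[simp] theorem actL_mul_X (M : Bifact d) (f : Poly) (i : Fin 2) (m : M) :
    actL M (f * MvPolynomial.X i) m = actL M f (M.xl m) := by
  simp [actL, diagonal]
@[simp] theorem actR_mul_X (M : Bifact d) (f : Poly) (i : Fin 2) (m : M) :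
    actR M (f * MvPolynomial.X i) m = actR M f (M.xr m) := by
  simp [actR, diagonal]
@[simp] theorem actL_C (M : Bifact d) (c : ℂ) (m : M) : actL M (MvPolynomial.C c) m = c • m := by
  simp [actL, diagonal, Polynomial.aeval_C]
@[simp] theorem actR_C (M : Bifact d) (c : ℂ) (m : M) : actR M (MvPolynomial.C c) m = c • m := by
  simp [actR, diagonal, Polynomial.aeval_C]

/-- A map that commutes with the left actions commutes with `actL`. -/
theorem actL_comm {M N : Bifact d} (A : M →ₗ[ℂ] N) (hA : ∀ m, A (M.xl m) = N.xl (A m))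
    (f : Poly) (m : M) : actL N f (A m) = A (actL M f m) := by
  induction f using MvPolynomial.induction_on generalizing m with
  | C c => simp
  | add f g hf hg => simp [hf, hg]
  | mul_X f i hf => simp [← hA, hf]

theorem actR_comm {M N : Bifact d} (A : M →ₗ[ℂ] N) (hA : ∀ m, A (M.xr m) = N.xr (A m))
    (f : Poly) (m : M) : actR N f (A m) = A (actR M f m) := by
  induction f using MvPolynomial.induction_on generalizing m with
  | C c => simp
  | add f g hf hg => simp [hf, hg]
  | mul_X f i hf => simp [← hA, hf]

theorem chg_actL (M : Bifact d) (f : Poly) (m : M) :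
    M.chg (actL M f m) = actL M f (M.chg m) + (2 / d : ℂ) • actL M (euler f) m := by
  induction f using MvPolynomial.induction_on generalizing m with
  | C c => simp
  | add f g hf hg => simp [hf, hg]; abel
  | mul_X f i hf => simp [hf, M.chg_xl, mul_comm _ (euler f)]; abel

theorem chg_actR (M : Bifact d) (f : Poly) (m : M) :
    M.chg (actR M f m) = actR M f (M.chg m) + (2 / d : ℂ) • actR M (euler f) m := by
  induction f using MvPolynomial.induction_on generalizing m with
  | C c => simp
  | add f g hf hg => simp [hf, hg]; abel
  | mul_X f i hf => simp [hf, M.chg_xr, mul_comm _ (euler f)]; abel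

/-- `f (x, y) ↦ f (u x, v y)`. -/
def scale (u v : ℂ) : Poly →ₐ[ℂ] Poly :=
  MvPolynomial.aeval ![MvPolynomial.C u * MvPolynomial.X 0, MvPolynomial.C v * MvPolynomial.X 1]

@[simp] theorem scale_X_zero (u v : ℂ) :
    scale u v (MvPolynomial.X 0) = MvPolynomial.C u * MvPolynomial.X 0 := by simp [scale]
@[simp] theorem scale_X_one (u v : ℂ) :
    scale u v (MvPolynomial.X 1) = MvPolynomial.C v * MvPolynomial.X 1 := by simp [scale]
@[simp] theorem scale_C (u v c : ℂ) : scale u v (MvPolynomial.C c) = MvPolynomial.C c := by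
  simp [scale, MvPolynomial.algebraMap_eq]

theorem euler_scale (u v : ℂ) (f : Poly) : euler (scale u v f) = scale u v (euler f) := by
  induction f using MvPolynomial.induction_on with
  | C c => simp
  | add f g hf hg => simp [hf, hg]
  | mul_X f i hf =>
    fin_cases i <;> simp [hf]

theorem scale_scale (u v u' v' : ℂ) (hu : u * u' = 1) (hv : v * v' = 1) (f : Poly) :
    scale u v (scale u' v' f) = f := by
  have e : ((scale u v).comp (scale u' v')) = AlgHom.id ℂ Poly := by
    refine MvPolynomial.algHom_ext fun i => ?_
    fin_cases i
    · have e := congrArg (MvPolynomial.C (σ := Fin 2)) hu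
      simp only [map_mul, map_one] at e
      simp
      linear_combination MvPolynomial.X 0 * e
    · have e := congrArg (MvPolynomial.C (σ := Fin 2)) hv
      simp only [map_mul, map_one] at e
      simp
      linear_combination MvPolynomial.X 1 * e
  exact congrArg (fun k => k f) e

variable [NeZero d]

/-- `η ^ a` for `a ∈ ℤ/d`, where `η = exp (2 π i / d)`. -/
abbrev etaPow (a : ZMod d) : ℂ := ZMod.stdAddChar a

theorem etaPow_eq (k : ℤ) :
    etaPow (k : ZMod d) = Complex.exp (2 * Real.pi * Complex.I / d) ^ k := by
  rw [etaPow, ZMod.stdAddChar_coe, ← Complex.exp_int_mul]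
  congr 1
  ring

/-- `∏ (x - η ^ j y)` over `j ∈ S`. -/
def permProd (S : Finset (ZMod d)) : Poly :=
  ∏ j ∈ S, (MvPolynomial.X 0 - MvPolynomial.C (etaPow j) * MvPolynomial.X 1)

theorem euler_permProd (S : Finset (ZMod d)) :
    euler (permProd S) = (S.card : ℂ) • permProd S := by
  classical
  induction S using Finset.induction_on with
  | empty => simp [permProd]
  | insert j S hj ih =>
    rw [permProd, Finset.prod_insert hj, Finset.card_insert_of_notMem hj, ← permProd]
    simp [ih, MvPolynomial.smul_eq_C_mul]
    ring

theorem permProd_univ :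
    permProd (Finset.univ : Finset (ZMod d)) = MvPolynomial.X 0 ^ d - MvPolynomial.X 1 ^ d := by
  classical
  have h : IsPrimitiveRoot (MvPolynomial.C (etaPow (1 : ZMod d)) : Poly) d := by
    refine IsPrimitiveRoot.map_of_injective ?_ (MvPolynomial.C_injective (Fin 2) ℂ)
    have := etaPow_eq (d := d) 1
    rw [Int.cast_one, zpow_one] at this
    rw [this]
    exact Complex.isPrimitiveRoot_exp d (NeZero.ne d)
  rw [h.pow_sub_pow_eq_prod_sub_mul _ _ (NeZero.pos d), permProd]
  have hinj : Function.Injective fun j : ZMod d => (MvPolynomial.C (etaPow j) : Poly) :=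
    (MvPolynomial.C_injective (Fin 2) ℂ).comp ZMod.injective_stdAddChar
  have himg : Polynomial.nthRootsFinset d (1 : Poly) =
      Finset.univ.image fun j : ZMod d => (MvPolynomial.C (etaPow j) : Poly) := by
    symm
    refine Finset.eq_of_subset_of_card_le ?_ ?_
    · intro t ht
      obtain ⟨j, -, rfl⟩ := Finset.mem_image.1 ht
      rw [Polynomial.mem_nthRootsFinset (NeZero.pos d), ← map_pow, etaPow,
        ← AddChar.map_nsmul_eq_pow]
      simp
    · rw [h.card_nthRootsFinset, Finset.card_image_of_injective _ hinj, Finset.card_univ,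
        ZMod.card]
  rw [himg, Finset.prod_image (fun i _ j _ h => hinj h)]

theorem permProd_mul_compl (S : Finset (ZMod d)) :
    permProd S * permProd Sᶜ = MvPolynomial.X 0 ^ d - MvPolynomial.X 1 ^ d := by
  rw [← permProd_univ, permProd, permProd, permProd, Finset.prod_mul_prod_compl]

/-- Multiplication by a polynomial on both summands. -/
def mulBoth (p : Poly) : Module.End ℂ (Poly × Poly) :=
  (LinearMap.mulLeft ℂ p).prodMap (LinearMap.mulLeft ℂ p)

theorem mulBoth_pow (p : Poly) (k : ℕ) : mulBoth p ^ k = mulBoth (p ^ k) := by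
  induction k with
  | zero => ext <;> simp [mulBoth]
  | succ k ih =>
    rw [pow_succ, ih]
    refine LinearMap.ext fun f => ?_
    simp [mulBoth, pow_succ]

/-- The permutation type bifactorisation `P_S`: even part `ℂ[x, y]`, odd part `ℂ[x, y]`. The
differential is multiplication by `∏_{j ∈ S} (x - η ^ j y)` from the odd to the even part, and by
`(x ^ d - y ^ d) / ∏_{j ∈ S} (x - η ^ j y) = ∏_{j ∉ S} (x - η ^ j y)` from the even to the odd part.

The even generator has charge `(1 - |S|) / d`. This fixes the charge `(|S| + 1) / d - 1` of the odd
generator. -/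
def permFact (S : Finset (ZMod d)) : Bifact d where
  carrier := Poly × Poly
  xl := mulBoth (MvPolynomial.X 0)
  xr := mulBoth (MvPolynomial.X 1)
  par := LinearMap.id.prodMap (-LinearMap.id)
  chg := ((2 / d : ℂ) • euler.toLinearMap + ((1 - S.card) / d : ℂ) • LinearMap.id).prodMap
    ((2 / d : ℂ) • euler.toLinearMap + ((S.card + 1) / d - 1 : ℂ) • LinearMap.id)
  diff := ((LinearMap.mulLeft ℂ (permProd S)) ∘ₗ LinearMap.snd ℂ Poly Poly).prod
    ((LinearMap.mulLeft ℂ (permProd Sᶜ)) ∘ₗ LinearMap.fst ℂ Poly Poly)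
  xl_xr := by rintro ⟨f, g⟩; ext1 <;> simp [mulBoth] <;> ring
  par_par := by rintro ⟨f, g⟩; ext1 <;> simp
  par_xl := by rintro ⟨f, g⟩; ext1 <;> simp [mulBoth]
  par_xr := by rintro ⟨f, g⟩; ext1 <;> simp [mulBoth]
  chg_xl := by
    rintro ⟨f, g⟩; ext1 <;> simp [mulBoth, MvPolynomial.smul_eq_C_mul] <;> ring
  chg_xr := by
    rintro ⟨f, g⟩; ext1 <;> simp [mulBoth, MvPolynomial.smul_eq_C_mul] <;> ring
  chg_par := by rintro ⟨f, g⟩; ext1 <;> simp <;> ring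
  chg_diagonalisable := by
    rw [eq_top_iff]
    rintro ⟨f, g⟩ -
    have hfg : ((f, g) : Poly × Poly) = (f, 0) + (0, g) := by simp
    rw [hfg]
    refine add_mem ?_ ?_
    · induction f using MvPolynomial.induction_on' with
      | add f f' hf hf' =>
        have e : ((f + f', 0) : Poly × Poly) = (f, 0) + (f', 0) := by simp
        rw [e]
        exact add_mem (hf (by simp)) (hf' (by simp))
      | monomial u c =>
        refine Submodule.mem_iSup_of_mem
          ((2 / d : ℂ) * ((u 0 + u 1 : ℕ) : ℂ) + ((1 - S.card) / d : ℂ)) ?_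
        rw [Module.End.mem_eigenspace_iff]
        ext1 <;> simp [euler_monomial, add_smul, mul_smul]
    · induction g using MvPolynomial.induction_on' with
      | add f f' hf hf' =>
        have e : ((0, f + f') : Poly × Poly) = (0, f) + (0, f') := by simp
        rw [e]
        exact add_mem (hf (by simp)) (hf' (by simp))
      | monomial u c =>
        refine Submodule.mem_iSup_of_mem
          ((2 / d : ℂ) * ((u 0 + u 1 : ℕ) : ℂ) + ((S.card + 1) / d - 1 : ℂ)) ?_
        rw [Module.End.mem_eigenspace_iff]
        ext1 <;> simp [euler_monomial, add_smul, mul_smul]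
  diff_xl := by rintro ⟨f, g⟩; ext1 <;> simp [mulBoth] <;> ring
  diff_xr := by rintro ⟨f, g⟩; ext1 <;> simp [mulBoth] <;> ring
  diff_par := by rintro ⟨f, g⟩; ext1 <;> simp
  chg_diff := by
    have hd : (d : ℂ) ≠ 0 := NeZero.ne _
    have hc : ((Sᶜ).card : ℂ) = d - S.card := by
      rw [Finset.card_compl, ZMod.card, Nat.cast_sub (by simpa using S.card_le_univ)]
    rintro ⟨f, g⟩
    ext1
    · have e : (2 / d : ℂ) * S.card + (1 - S.card) / d = ((S.card + 1) / d - 1 : ℂ) + 1 := by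
        field_simp; ring
      have e' := congrArg (fun c => c • (permProd S * g)) e
      simp only [add_smul, mul_smul, one_smul] at e'
      simp [euler_permProd, mul_add, smul_add, mul_comm g] at e' ⊢
      linear_combination (exp := 1) e'
    · have e : (2 / d : ℂ) * (d - S.card) + ((S.card + 1) / d - 1 : ℂ) = (1 - S.card) / d + 1 := by
        field_simp; ring
      have e' := congrArg (fun c => c • (permProd Sᶜ * f)) e
      simp only [add_smul, mul_smul, one_smul] at e'
      simp [euler_permProd, mul_add, smul_add, hc, mul_comm f] at e' ⊢
      linear_combination (exp := 1) e'
  diff_diff := by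
    rintro ⟨f, g⟩
    rw [mulBoth_pow, mulBoth_pow]
    ext1
    · simp [mulBoth]
      linear_combination f * permProd_mul_compl S
    · simp [mulBoth]
      linear_combination g * permProd_mul_compl S

/-- The element of `P_S` with even part `f` and odd part `g`. -/
def el (S : Finset (ZMod d)) (f g : Poly) : permFact S := ((f, g) : Poly × Poly)

/-- The even part of an element of `P_S`, as a polynomial. -/
def evenPart (S : Finset (ZMod d)) : permFact S →ₗ[ℂ] Poly := LinearMap.fst ℂ Poly Poly

/-- The linear map `(f, g) ↦ (A f, B g)` from `P_S` to `P_T`. -/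
def permMap (S T : Finset (ZMod d)) (A B : Poly →ₗ[ℂ] Poly) : permFact S →ₗ[ℂ] permFact T :=
  (A.prodMap B : Poly × Poly →ₗ[ℂ] Poly × Poly)

section el

variable (S T : Finset (ZMod d)) (f g : Poly)

theorem exists_el (t : permFact S) : ∃ f g, t = el S f g := ⟨t.1, t.2, rfl⟩
@[simp] theorem evenPart_el : evenPart S (el S f g) = f := rfl
@[simp] theorem permMap_el (A B : Poly →ₗ[ℂ] Poly) :
    permMap S T A B (el S f g) = el T (A f) (B g) := rfl
theorem add_el (f' g' : Poly) : el S f g + el S f' g' = el S (f + f') (g + g') := rfl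
theorem smul_el (c : ℂ) : c • el S f g = el S (c • f) (c • g) := rfl
@[simp] theorem xl_el : (permFact S).xl (el S f g) =
    el S (MvPolynomial.X 0 * f) (MvPolynomial.X 0 * g) := rfl
@[simp] theorem xr_el : (permFact S).xr (el S f g) =
    el S (MvPolynomial.X 1 * f) (MvPolynomial.X 1 * g) := rfl
@[simp] theorem par_el : (permFact S).par (el S f g) = el S f (-g) := rfl
@[simp] theorem chg_el : (permFact S).chg (el S f g) =
    el S ((2 / d : ℂ) • euler f + ((1 - S.card) / d : ℂ) • f)
      ((2 / d : ℂ) • euler g + ((S.card + 1) / d - 1 : ℂ) • g) := rfl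
@[simp] theorem diff_el : (permFact S).diff (el S f g) =
    el S (permProd S * g) (permProd Sᶜ * f) := rfl

end el

/-- `{m, …, m + l}` in `ℤ/d`. -/
def interval (m : ZMod d) (l : ℕ) : Finset (ZMod d) :=
  (Finset.range (l + 1)).image fun j : ℕ => m + (j : ZMod d)

/-- The translate `S + a`. -/
def shiftSet (S : Finset (ZMod d)) (a : ZMod d) : Finset (ZMod d) := S.image (· + a)

/-- `P_{m;l}`, the permutation type bifactorisation of `{m, …, m + l}`. -/
abbrev permInterval (m : ZMod d) (l : ℕ) : Bifact d := permFact (interval m l)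

/-- The invertible objects `P_{a;0}`. -/
abbrev line (a : ZMod d) : Bifact d := permFact {a}

/-- The tensor unit `P_{0;0}`. -/
abbrev unitObj (d : ℕ) [NeZero d] : Bifact d := permFact {0}

/-! ### The unitors -/

theorem actL_unit (M : Bifact d) (f : Poly) : actL M (permProd {(0 : ZMod d)} * f) = 0 := by
  simp [actL, permProd, diagonal]

theorem actR_unit (M : Bifact d) (f : Poly) : actR M (permProd {(0 : ZMod d)} * f) = 0 := by
  simp [actR, permProd, diagonal]

/-- The left unitor `f (x, y) ⊗ m ↦ f (x, x) m`, zero on the odd part of the unit. -/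
def leftUnitor (M : Bifact d) : unitObj d ⊙ M ⟶ M :=
  homClass ⟨tensorLift (actL M ∘ₗ evenPart {0}) (by
      intro t m
      obtain ⟨f, g, rfl⟩ := exists_el _ t
      simp [mul_comm _ f]), by
    refine ⟨?_, ?_, ?_, ?_, ?_⟩ <;> intro t <;> induction t using tensor_induction with
      | add s t hs ht => simp only [map_add, hs, ht]
      | tmul t m =>
        obtain ⟨f, g, rfl⟩ := exists_el _ t
        first
        | simp [mul_comm _ f, actL_comm M.xl (fun _ => rfl)]; done
        | simp [actL_comm M.xr (fun m => (M.xl_xr m).symm)]; done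
        | simp [actL_comm M.par M.par_xl]; done
        | simp [chg_actL]; abel; done
        | simp [actL_comm M.diff M.diff_xl, actL_unit]; done⟩

/-- The right unitor `m ⊗ f (x, y) ↦ m f (y, y)`, zero on the odd part of the unit. -/
def rightUnitor (M : Bifact d) : M ⊙ unitObj d ⟶ M :=
  homClass ⟨tensorLift (actR M ∘ₗ evenPart {0}).flip (by
      intro m t
      obtain ⟨f, g, rfl⟩ := exists_el _ t
      simp [mul_comm _ f]), by
    refine ⟨?_, ?_, ?_, ?_, ?_⟩ <;> intro t <;> induction t using tensor_induction with
      | add s t hs ht => simp only [map_add, hs, ht]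
      | tmul m t =>
        obtain ⟨f, g, rfl⟩ := exists_el _ t
        first
        | simp [actR_comm M.xl M.xl_xr]; done
        | simp [mul_comm _ f, actR_comm M.xr (fun _ => rfl)]; done
        | simp [actR_comm M.par M.par_xr]; done
        | simp [chg_actR]; done
        | simp [actR_comm M.diff M.diff_xr, actR_unit]; done⟩

/-! ### Twisting -/

theorem etaPow_pow (a : ZMod d) : etaPow a ^ d = 1 := by
  rw [etaPow, ← AddChar.map_nsmul_eq_pow]
  simp

/-- The twist `_a M_b`: `x` acts on the left as `η ^ (-a) x` and on the right as `η ^ b x`. -/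
def twist (a b : ZMod d) (M : Bifact d) : Bifact d where
  carrier := M
  xl := etaPow (-a) • M.xl
  xr := etaPow b • M.xr
  par := M.par
  chg := M.chg
  diff := M.diff
  xl_xr m := by simp [M.xl_xr, smul_comm (etaPow b)]
  par_par := M.par_par
  par_xl m := by simp [M.par_xl]
  par_xr m := by simp [M.par_xr]
  chg_xl m := by simp [M.chg_xl, smul_comm (etaPow (-a))]
  chg_xr m := by simp [M.chg_xr, smul_comm (etaPow b)]
  chg_par := M.chg_par
  chg_diagonalisable := M.chg_diagonalisable
  diff_xl m := by simp [M.diff_xl]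
  diff_xr m := by simp [M.diff_xr]
  diff_par := M.diff_par
  chg_diff := M.chg_diff
  diff_diff m := by rw [smul_pow, smul_pow, etaPow_pow, etaPow_pow, one_smul, one_smul, M.diff_diff]

/-- The identity map onto the twist. -/
def toTwist (a b : ZMod d) (M : Bifact d) : M →ₗ[ℂ] twist a b M := LinearMap.id (M := M)

/-- The identity map from the twist. -/
def ofTwist (a b : ZMod d) (M : Bifact d) : twist a b M →ₗ[ℂ] M := LinearMap.id (M := M)

section toTwist

variable (a b : ZMod d) (M : Bifact d) (m : M)

@[simp] theorem ofTwist_toTwist : ofTwist a b M (toTwist a b M m) = m := rfl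
@[simp] theorem toTwist_ofTwist (t : twist a b M) : toTwist a b M (ofTwist a b M t) = t := rfl
theorem exists_toTwist (t : twist a b M) : ∃ m, t = toTwist a b M m := ⟨t, rfl⟩
@[simp] theorem xl_toTwist :
    (twist a b M).xl (toTwist a b M m) = etaPow (-a) • toTwist a b M (M.xl m) := rfl
@[simp] theorem xr_toTwist :
    (twist a b M).xr (toTwist a b M m) = etaPow b • toTwist a b M (M.xr m) := rfl
@[simp] theorem par_toTwist : (twist a b M).par (toTwist a b M m) = toTwist a b M (M.par m) := rfl
@[simp] theorem chg_toTwist : (twist a b M).chg (toTwist a b M m) = toTwist a b M (M.chg m) := rfl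
@[simp] theorem diff_toTwist :
    (twist a b M).diff (toTwist a b M m) = toTwist a b M (M.diff m) := rfl

end toTwist

/-- The identification `M_a ⊗ N = M ⊗ _a N`, which is the identity on pure tensors. -/
def twistMiddle (a : ZMod d) (M N : Bifact d) : twist 0 a M ⊙ N ≅ M ⊙ twist a 0 N :=
  isoMk
    ⟨tensorLift ((tmulL M (twist a 0 N)).compl₁₂ (ofTwist 0 a M) (toTwist a 0 N)) (by
      intro t n
      obtain ⟨m, hm⟩ := exists_toTwist _ _ _ t
      rw [hm]
      simp [xr_tmul, smul_smul, ← AddChar.map_add_eq_mul]), by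
      refine ⟨?_, ?_, ?_, ?_, ?_⟩ <;> intro t <;> induction t using tensor_induction with
        | add s t hs ht => simp only [map_add, hs, ht]
        | tmul t n =>
          obtain ⟨m, hm⟩ := exists_toTwist _ _ _ t
          rw [hm]
          simp⟩
    (tensorLift ((tmulL (twist 0 a M) N).compl₁₂ (toTwist 0 a M) (ofTwist a 0 N)) (by
      intro m t
      obtain ⟨n, hn⟩ := exists_toTwist _ _ _ t
      rw [hn]
      have h := xr_tmul (toTwist 0 a M m) n
      simp only [xr_toTwist, smul_tmul] at h
      simp [← h, smul_smul, ← AddChar.map_add_eq_mul]))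
    (fun t => by
      induction t using tensor_induction with
      | add s t hs ht => simp only [map_add, hs, ht]
      | tmul m n => simp)
    (fun t => by
      induction t using tensor_induction with
      | add s t hs ht => simp only [map_add, hs, ht]
      | tmul m n => simp)

theorem card_shiftSet (S : Finset (ZMod d)) (a : ZMod d) : (shiftSet S a).card = S.card :=
  Finset.card_image_of_injective _ (add_left_injective a)

theorem shiftSet_compl (S : Finset (ZMod d)) (a : ZMod d) :
    (shiftSet S a)ᶜ = shiftSet Sᶜ a :=
  by
  ext j
  simp [shiftSet, ← eq_sub_iff_add_eq]

theorem scale_permProd (a b : ZMod d) (S : Finset (ZMod d)) :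
    scale (etaPow (-a)) (etaPow b) (permProd (shiftSet S (-a - b))) =
      etaPow (-((S.card : ZMod d) * a)) • permProd S := by
  have e0 : etaPow (-((S.card : ZMod d) * a)) = etaPow (-a) ^ S.card := by
    rw [← AddChar.map_nsmul_eq_pow]
    simp
  rw [permProd, shiftSet, Finset.prod_image (fun i _ j _ h => add_left_injective _ h), map_prod,
    e0, permProd, ← Finset.prod_const, MvPolynomial.smul_eq_C_mul, map_prod, ← Finset.prod_mul_distrib]
  refine Finset.prod_congr rfl fun j _ => ?_
  have e : etaPow (j + (-a - b)) * etaPow b = etaPow (-a) * etaPow j := by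
    rw [← AddChar.map_add_eq_mul, ← AddChar.map_add_eq_mul]
    congr 1
    ring
  have e' := congrArg (MvPolynomial.C (σ := Fin 2)) e
  simp only [map_mul] at e'
  simp only [map_sub, map_mul, scale_X_zero, scale_X_one, scale_C]
  linear_combination (-MvPolynomial.X 1) * e'

theorem scale_permProd_compl (a b : ZMod d) (S : Finset (ZMod d)) :
    scale (etaPow (-a)) (etaPow b) (permProd (shiftSet S (-a - b))ᶜ) =
      etaPow ((S.card : ZMod d) * a) • permProd Sᶜ := by
  rw [shiftSet_compl, scale_permProd, Finset.card_compl, ZMod.card,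
    Nat.cast_sub (by simpa using S.card_le_univ)]
  simp

/-- The untwisting isomorphism `s_{a,b} : P_{S-a-b} → _a (P_S)_b`. -/
def untwist (a b : ZMod d) {S T : Finset (ZMod d)} (h : T = shiftSet S (-a - b)) :
    permFact T ≅ twist a b (permFact S) :=
  isoMk
    ⟨toTwist a b (permFact S) ∘ₗ permMap T S (scale (etaPow (-a)) (etaPow b)).toLinearMap
      (etaPow (-((S.card : ZMod d) * a)) • (scale (etaPow (-a)) (etaPow b)).toLinearMap), by
      subst h
      refine ⟨?_, ?_, ?_, ?_, ?_⟩ <;> intro t <;> obtain ⟨f, g, rfl⟩ := exists_el _ t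
      · simp [← map_smul, smul_el, MvPolynomial.smul_eq_C_mul, mul_assoc, mul_left_comm]
      · simp [← map_smul, smul_el, MvPolynomial.smul_eq_C_mul, mul_assoc, mul_left_comm]
      · simp
      · simp [euler_scale, card_shiftSet, smul_comm (etaPow (-((S.card : ZMod d) * a)))]
      · simp [scale_permProd, scale_permProd_compl, smul_smul, ← AddChar.map_add_eq_mul]⟩
    (permMap S T (scale (etaPow a) (etaPow (-b))).toLinearMap
      (etaPow ((S.card : ZMod d) * a) • (scale (etaPow a) (etaPow (-b))).toLinearMap) ∘ₗ
      ofTwist a b (permFact S))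
    (fun t => by
      obtain ⟨f, g, rfl⟩ := exists_el _ t
      simp [scale_scale, smul_smul, ← AddChar.map_add_eq_mul])
    (fun t => by
      obtain ⟨t, ht⟩ := exists_toTwist _ _ _ t
      rw [ht]
      obtain ⟨f, g, rfl⟩ := exists_el _ t
      simp [scale_scale, smul_smul, ← AddChar.map_add_eq_mul])

/-! ### Fusion with the invertible objects -/

/-- `ψ^L_{a;S} : a P_S → P_{S+a}`. -/
def psiL (a : ZMod d) {S T : Finset (ZMod d)} (h : T = shiftSet S a) :
    line a ⊙ permFact S ⟶ permFact T :=
  ((untwist 0 (-a) (S := {0}) (T := {a}) (by simp [shiftSet])).hom ⊙ₘ 𝟙 (permFact S)) ≫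
    (twistMiddle (-a) (unitObj d) (permFact S)).hom ≫
    (𝟙 (unitObj d) ⊙ₘ (untwist (-a) 0 (S := S) (T := T) (by simpa using h)).inv) ≫
    leftUnitor (permFact T)

/-- `ψ^R_{S;a} : P_S a → P_{S+a}`. -/
def psiR (a : ZMod d) {S T : Finset (ZMod d)} (h : T = shiftSet S a) :
    permFact S ⊙ line a ⟶ permFact T :=
  (𝟙 (permFact S) ⊙ₘ (untwist (-a) 0 (S := {0}) (T := {a}) (by simp [shiftSet])).hom) ≫
    (twistMiddle (-a) (permFact S) (unitObj d)).inv ≫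
    ((untwist 0 (-a) (S := S) (T := T) (by simpa using h)).inv ⊙ₘ 𝟙 (unitObj d)) ≫
    rightUnitor (permFact T)

/-- The evaluation `ev_a : (-a) a → 1`. -/
def ev (a : ZMod d) : line (-a) ⊙ line a ⟶ unitObj d := 
  psiL (-a) (S := {a}) (T := {0}) (by simp [shiftSet])

theorem shiftSet_neg (S : Finset (ZMod d)) (a : ZMod d) :
    S = shiftSet (shiftSet S a) (-a) := by
  ext j
  simp [shiftSet]

theorem shiftSet_neg' (S : Finset (ZMod d)) (a : ZMod d) :
    S = shiftSet (shiftSet S (-a)) a := by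
  ext j
  simp [shiftSet]

/-! ### The two sides of the identity

The morphisms below use the inverses of `ψ^L` and `ψ^R` in the homotopy category. -/

section conj

variable [∀ (a : ZMod d) (S T : Finset (ZMod d)) (h : T = shiftSet S a), IsIso (psiL a h)]
  [∀ (a : ZMod d) (S T : Finset (ZMod d)) (h : T = shiftSet S a), IsIso (psiR a h)]

/-- `P_S → P_{S+a} (-a) → (a P_S) (-a)`, by the inverses of `ψ^R_{S+a;-a}` and `ψ^L_{a;S}`. -/
def conjL (a : ZMod d) (S : Finset (ZMod d)) :
    permFact S ⟶ (line a ⊙ permFact S) ⊙ line (-a) :=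
  inv (psiR (-a) (S := shiftSet S a) (T := S) (shiftSet_neg S a)) ≫
    (inv (psiL a (S := S) (T := shiftSet S a) rfl) ⊙ₘ 𝟙 (line (-a)))

/-- `P_S → a P_{S-a} → a (P_S (-a))`, by the inverses of `ψ^L_{a;S-a}` and `ψ^R_{S;-a}`. -/
def conjR (a : ZMod d) (S : Finset (ZMod d)) :
    permFact S ⟶ line a ⊙ (permFact S ⊙ line (-a)) :=
  inv (psiL a (S := shiftSet S (-a)) (T := S) (shiftSet_neg' S a)) ≫
    (𝟙 (line a) ⊙ₘ inv (psiR (-a) (S := S) (T := shiftSet S (-a)) rfl))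

/-- The evaluation cap: `((a M) (-a)) (a (N (-a))) → (a (M N)) (-a)`, which is `1 ⊗ ev_a ⊗ 1`
applied to the two middle factors, up to associators and a unitor. -/
def cap (a : ZMod d) (M N : Bifact d) :
    ((line a ⊙ M) ⊙ line (-a)) ⊙ (line a ⊙ (N ⊙ line (-a))) ⟶
      (line a ⊙ (M ⊙ N)) ⊙ line (-a) :=
  (associator (line a ⊙ M) (line (-a)) (line a ⊙ (N ⊙ line (-a)))).hom ≫
    (𝟙 (line a ⊙ M) ⊙ₘ
      ((associator (line (-a)) (line a) (N ⊙ line (-a))).inv ≫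
        (ev a ⊙ₘ 𝟙 (N ⊙ line (-a))) ≫ leftUnitor (N ⊙ line (-a)))) ≫
    (associator (line a ⊙ M) N (line (-a))).inv ≫
    ((associator (line a) M N).hom ⊙ₘ 𝟙 (line (-a)))

/-- The left-hand diagram: `P_S → (a P_S) (-a) → (a (P_{S'} P_{S''})) (-a)`, that is, `1 ⊗ φ ⊗ 1`
after the fusion of `a` and `-a` into the strand below the vertex. -/
def conjOutside (a : ZMod d) {S S' S'' : Finset (ZMod d)}
    (φ : permFact S ⟶ permFact S' ⊙ permFact S'') :
    permFact S ⟶ (line a ⊙ (permFact S' ⊙ permFact S'')) ⊙ line (-a) :=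
  conjL a S ≫ ((𝟙 (line a) ⊙ₘ φ) ⊙ₘ 𝟙 (line (-a)))

/-- The right-hand diagram: the vertex `φ`, followed by the fusion of `a` and `-a` into each of
the two legs, the inner `-a` and `a` being joined by the evaluation cap. -/
def conjLegs (a : ZMod d) {S S' S'' : Finset (ZMod d)}
    (φ : permFact S ⟶ permFact S' ⊙ permFact S'') :
    permFact S ⟶ (line a ⊙ (permFact S' ⊙ permFact S'')) ⊙ line (-a) :=
  φ ≫ (conjL a S' ⊙ₘ conjR a S'') ≫ cap a (permFact S') (permFact S'')

end conj

end perm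

end

end LandauGinzburg

open CategoryTheory LandauGinzburg

/-! Twisting makes the two sides comparable. For any `M`, `s_{0,-a}` and the unitor turn a left
factor `a` into a twist: `f ⊗ m` goes to `f(η^a x, x).m` in `_{-a}M`. The same works on the right,
so `a (M N) (-a)` maps to `_{-a}(M N)_a`, by an isomorphism when `M` and `N` are of the form `P_S`;
this is `conjTwist`. The fusion isomorphisms between `a P_S (-a)` and `P_S` are these absorptions
followed by inverse untwistings, which cancel against `s_{-a,a} : P_S → _{-a}(P_S)_a`. Hence both
`κ^L` and `κ^R` become `s_{-a,a}`, and the evaluation cap becomes multiplication in the middle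
variable. The claim reduces to comparing `s_{-a,a}` followed by `φ` with `φ` followed by `s_{-a,a} ⊗
s_{-a,a}` (`conjOutside_comp_conjTwist`, `conjLegs_comp_conjTwist`).

That comparison is a matter of gradings. On a homogeneous polynomial of degree `n` the map
`s_{-a,a}` is multiplication by `η^{an}`, with a further `η^{a|S|}` on the odd part. Expressed
through the charge `q`, both parts give `exp(πia(q + (|S|-1)/d))`, up to `(-1)^a` on the odd part,
which is the `a`-th power of the parity operator (`selfTwist_actsByCharge`). A morphism preserves
charge and parity, and charges add and parities multiply under `⊗`, so only the constants
`(|S|-1)/d` fail to cancel. For intervals `|S| - 1 = l`, whence the scalar `exp(πia(l-l'-l'')/d)`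
(`selfTwist_comp_twistCycle`). Here the identity already holds between chain maps.

Homotopies are needed only to invert `ψ^L` and `ψ^R`, that is, the unitors on `P_S`. The component
`x - y` of the differential of the unit is a Koszul resolution of the diagonal. Since `P_S` is free
as a bimodule, this resolution is contracted bilinearly onto `P_S`, and a perturbation argument
takes care of the rest of the differential (`isIso_of_contraction`). -/

namespace LandauGinzburg

noncomputable section

/-! ### A contraction criterion for homotopy equivalences -/

section

variable {d : ℕ}

/-- The homotopy class of a chain map, as a morphism. -/
def homMk {M N : Bifact d} (f : cycles M N) : M ⟶ N := homClass f

theorem homMk_comp {M N P : Bifact d} (f : cycles M N) (g : cycles N P) :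
    homMk f ≫ homMk g = homMk (cyclesComp f g) := rfl

theorem homMk_congr {M N : Bifact d} {f g : cycles M N} (h : ∀ m, f.1 m = g.1 m) :
    homMk f = homMk g :=
  congrArg homClass (Subtype.ext (LinearMap.ext h))

/-- A chain map `p` with a bilinear section `s` is a homotopy equivalence if there is a bilinear
contraction `h` of the part `A₁` of the differential `A₁ + A₂ + B`, whose image lies in the
range of the projection `Q`. -/
theorem isIso_of_contraction {C M : Bifact d} (p : cycles C M) (s : M →ₗ[ℂ] C)
    (h A₁ A₂ B Q : C →ₗ[ℂ] C)
    (ps : ∀ m, p.1 (s m) = m)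
    (s_xl : ∀ m, s (M.xl m) = C.xl (s m)) (s_xr : ∀ m, s (M.xr m) = C.xr (s m))
    (s_par : ∀ m, s (M.par m) = C.par (s m)) (s_chg : ∀ m, s (M.chg m) = C.chg (s m))
    (h_xl : ∀ c, h (C.xl c) = C.xl (h c)) (h_xr : ∀ c, h (C.xr c) = C.xr (h c))
    (h_par : ∀ c, h (C.par c) = -C.par (h c)) (h_chg : ∀ c, C.chg (h c) = h (C.chg c) - h c)
    (hD : ∀ c, C.diff c = A₁ c + A₂ c + B c)
    (hA : ∀ c, h (A₁ c) + A₁ (h c) = c - s (p.1 c))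
    (Qh : ∀ c, Q (h c) = h c) (hQ : ∀ c, h (Q c) = 0) (pQ : ∀ c, p.1 (Q c) = 0)
    (A₂Q : ∀ c, A₂ (Q c) = 0) (QA₂ : ∀ c, Q (A₂ c) = A₂ c) (BQ : ∀ c, B (Q c) = Q (B c))
    (BA : ∀ c, B (A₁ c) + A₁ (B c) = 0) (pA : ∀ c, p.1 (A₁ c) = 0)
    (pB : ∀ c, p.1 (B c) = M.diff (p.1 c)) : IsIso (homMk p) := by
  obtain ⟨p, p1, p2, p3, p4, p5⟩ := p
  dsimp only at *
  have hh : ∀ c, h (h c) = 0 := fun c => by rw [← Qh c, hQ]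
  have ph : ∀ c, p (h c) = 0 := fun c => by rw [← Qh c, pQ]
  have hBh : ∀ c, h (B (h c)) = 0 := fun c => by rw [← Qh c, BQ, hQ]
  have hA₂ : ∀ c, h (A₂ c) = 0 := fun c => by rw [← QA₂ c, hQ]
  have A₂h : ∀ c, A₂ (h c) = 0 := fun c => by rw [← Qh c, A₂Q]
  have comm : ∀ k, p k = 0 → B (h k) + h (B k) = 0 := by
    intro k hk
    have pBk : p (B k) = 0 := by rw [pB, hk, map_zero]
    have e1 : A₁ (h k) = k - h (A₁ k) := by
      rw [eq_sub_iff_add_eq']; simpa [hk] using hA k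
    have e2 : A₁ (h (B k)) = B k - h (A₁ (B k)) := by
      rw [eq_sub_iff_add_eq']; simpa [pBk] using hA (B k)
    have e3 : A₁ (B (h k) + h (B k)) = B (h (A₁ k)) + h (B (A₁ k)) := by
      have e4 := BA (h k)
      rw [e1, map_sub] at e4
      have e5 := congrArg h (BA k)
      rw [map_add, map_zero] at e5
      rw [map_add, e2, eq_neg_of_add_eq_zero_right e4, eq_neg_of_add_eq_zero_left e5]
      abel
    have e6 := hA (B (h k) + h (B k))
    rw [e3] at e6
    simpa [hBh, hh, ph, pB] using e6.symm
  -- `A₂` dies on both sides of `h` and `B` anticommutes with `h`, so on the kernel of `p` the map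
  -- `h` contracts the whole differential and not only `A₁`.
  have contr : ∀ k, p k = 0 → C.diff (h k) + h (C.diff k) = k := by
    intro k hk
    have e1 := comm k hk
    have e2 := hA k
    rw [hk, map_zero, sub_zero] at e2
    rw [hD, hD, map_add, map_add, A₂h, hA₂]
    calc _ = (h (A₁ k) + A₁ (h k)) + (B (h k) + h (B k)) := by abel
      _ = k := by rw [e1, e2, add_zero]
  -- The defect of `s` as a chain map. Its values lie in the kernel of `p`, where `h` is a
  -- contraction, so subtracting `h ∘ Er` from `s` repairs it.
  let Er : M →ₗ[ℂ] C := C.diff ∘ₗ s - s ∘ₗ M.diff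
  have Er_apply : ∀ m, Er m = C.diff (s m) - s (M.diff m) := fun m => rfl
  have pE : ∀ m, p (Er m) = 0 := fun m => by simp [Er_apply, p5, ps]
  have s_pow_l : ∀ (k : ℕ) m, s ((M.xl ^ k) m) = (C.xl ^ k) (s m) := fun k => by
    induction k with
    | zero => intro m; rfl
    | succ k ih => intro m; rw [pow_succ, pow_succ, Module.End.mul_apply, ih, s_xl]; rfl
  have s_pow_r : ∀ (k : ℕ) m, s ((M.xr ^ k) m) = (C.xr ^ k) (s m) := fun k => by
    induction k with
    | zero => intro m; rfl
    | succ k ih => intro m; rw [pow_succ, pow_succ, Module.End.mul_apply, ih, s_xr]; rfl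
  -- Both squared differentials are the left minus the right action of `x ^ d`, with which the
  -- bilinear `s` commutes.
  have DE : ∀ m, C.diff (Er m) = -Er (M.diff m) := fun m => by
    simp [Er_apply, C.diff_diff, M.diff_diff, s_pow_l, s_pow_r]
  let t : M →ₗ[ℂ] C := s - h ∘ₗ Er
  have t_apply : ∀ m, t m = s m - h (Er m) := fun m => rfl
  have pt : ∀ m, p (t m) = m := fun m => by simp [t_apply, ps, ph]
  have ht : t ∈ cycles M C := by
    refine ⟨?_, ?_, ?_, ?_, ?_⟩ <;> intro m
    · simp [t_apply, Er_apply, s_xl, h_xl, M.diff_xl, C.diff_xl]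
    · simp [t_apply, Er_apply, s_xr, h_xr, M.diff_xr, C.diff_xr]
    · simp [t_apply, Er_apply, s_par, h_par, M.diff_par, C.diff_par]; abel
    · have e1 : s (M.chg (M.diff m)) = C.chg (s (M.diff m)) := s_chg _
      have e2 := h_chg (Er m)
      have e3 : C.chg (Er m) = Er (M.chg m) + Er m := by
        simp only [Er_apply, map_sub, C.chg_diff, ← s_chg, M.chg_diff, map_add]
        abel
      rw [e3, map_add, add_sub_cancel_right] at e2
      simp [t_apply, s_chg, e2]
    · have e1 := contr (Er m) (pE m)
      rw [DE, map_neg, ← sub_eq_add_neg, sub_eq_iff_eq_add] at e1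
      rw [t_apply, t_apply, map_sub, e1, Er_apply m]
      abel
  let g : cycles M C := ⟨t, ht⟩
  -- As `p t = 1`, the idempotent `1 - t p` is a chain map into the kernel of `p`; composing it with
  -- the contraction there gives a homotopy from the identity to `t p`.
  let k : C →ₗ[ℂ] C := h ∘ₗ (LinearMap.id - t ∘ₗ p)
  have k_apply : ∀ c, k c = h (c - t (p c)) := fun c => rfl
  obtain ⟨t1, t2, t3, t4, t5⟩ := ht
  refine ⟨homMk g, ?_, ?_⟩
  · symm
    refine homClass_eq.2 ⟨k, ?_, ?_, ?_, ?_, ?_⟩ <;> intro c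
    · simp only [k_apply, p1, t1, ← map_sub, h_xl]
    · simp only [k_apply, p2, t2, ← map_sub, h_xr]
    · simp only [k_apply, p3, t3, ← map_sub, h_par]
    · simp only [k_apply, p4, t4, ← map_sub, h_chg]
    · rw [k_apply, k_apply, p5, t5, ← map_sub, contr]
      · rfl
      · rw [map_sub, pt, sub_self]
  · exact homMk_congr pt

end

/-! ### Recursively defined maps out of polynomials and out of `P_S` -/

section

variable {d : ℕ}

/-- Linear maps out of `ℂ[x, y]` that satisfy a recursion in both variables. -/
theorem exists_polyRec {E : Type*} [AddCommGroup E] [Module ℂ E] (X Y : Module.End ℂ E)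
    (hXY : ∀ e, X (Y e) = Y (X e)) (a b : Poly →ₗ[ℂ] E)
    (hab : ∀ f, a (MvPolynomial.X 1 * f) + X (b f) = b (MvPolynomial.X 0 * f) + Y (a f)) (e : E) :
    ∃ F : Poly →ₗ[ℂ] E, F 1 = e ∧ (∀ f, F (MvPolynomial.X 0 * f) = X (F f) + a f) ∧
      ∀ f, F (MvPolynomial.X 1 * f) = Y (F f) + b f := by
  -- An inhomogeneous recursion becomes a module structure on `Poly × E`: `X'` and `Y'` are block
  -- triangular with off-diagonal entries `a` and `b`, and `hab` says that they commute. The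
  -- solution is the second component of `f ↦ f(X', Y') (1, e)`, whose first component is `f`
  -- itself.
  let X' : Module.End ℂ (Poly × E) := (LinearMap.mulLeft ℂ (MvPolynomial.X 0) ∘ₗ
    LinearMap.fst ℂ Poly E).prod (X ∘ₗ LinearMap.snd ℂ Poly E + a ∘ₗ LinearMap.fst ℂ Poly E)
  let Y' : Module.End ℂ (Poly × E) := (LinearMap.mulLeft ℂ (MvPolynomial.X 1) ∘ₗ
    LinearMap.fst ℂ Poly E).prod (Y ∘ₗ LinearMap.snd ℂ Poly E + b ∘ₗ LinearMap.fst ℂ Poly E)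
  have hX' : ∀ t, X' t = (MvPolynomial.X 0 * t.1, X t.2 + a t.1) := fun t => rfl
  have hY' : ∀ t, Y' t = (MvPolynomial.X 1 * t.1, Y t.2 + b t.1) := fun t => rfl
  have hc : Commute X' Y' := by
    refine LinearMap.ext fun t => ?_
    have := hab t.1
    simp only [Module.End.mul_apply, hX', hY', map_add, hXY, Prod.mk.injEq]
    exact ⟨by ring, by rw [add_assoc, add_comm (X _), this]; abel⟩
  let G : Poly →ₗ[ℂ] Poly × E := (MvPolynomial.basisMonomials (Fin 2) ℂ).constr ℂ
    fun u => (X' ^ u 0) ((Y' ^ u 1) (1, e))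
  have hG : ∀ u c, G (MvPolynomial.monomial u c) = c • (X' ^ u 0) ((Y' ^ u 1) (1, e)) := by
    intro u c
    have e1 : (MvPolynomial.monomial u c : Poly) =
        c • MvPolynomial.basisMonomials (Fin 2) ℂ u := by
      simp [MvPolynomial.smul_monomial]
    rw [e1, map_smul, Module.Basis.constr_basis]
  have h1 : G 1 = (1, e) := by
    have := hG 0 1
    simpa using this
  have hX : ∀ f, G (MvPolynomial.X 0 * f) = X' (G f) := by
    intro f
    induction f using MvPolynomial.induction_on' with
    | add f g hf hg => rw [mul_add, map_add, map_add, map_add, hf, hg]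
    | monomial u c =>
      rw [MvPolynomial.X, MvPolynomial.monomial_mul, hG, hG, one_mul, map_smul]
      simp [add_comm 1, pow_succ', Module.End.mul_apply]
  have hY : ∀ f, G (MvPolynomial.X 1 * f) = Y' (G f) := by
    intro f
    induction f using MvPolynomial.induction_on' with
    | add f g hf hg => rw [mul_add, map_add, map_add, map_add, hf, hg]
    | monomial u c =>
      rw [MvPolynomial.X, MvPolynomial.monomial_mul, hG, hG, one_mul, map_smul,
        ← Module.End.mul_apply Y', ((hc.symm.pow_right _).eq)]
      simp [add_comm 1, pow_succ', Module.End.mul_apply]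
  have hfst : ∀ f, (G f).1 = f := by
    intro f
    induction f using MvPolynomial.induction_on with
    | C c =>
      rw [← mul_one (MvPolynomial.C c), ← MvPolynomial.smul_eq_C_mul, map_smul, h1]; rfl
    | add f g hf hg => rw [map_add, Prod.fst_add, hf, hg]
    | mul_X f i hf =>
      rw [mul_comm]
      fin_cases i
      · exact (congrArg Prod.fst (hX f)).trans (by rw [hX', hf]; rfl)
      · exact (congrArg Prod.fst (hY f)).trans (by rw [hY', hf]; rfl)
  refine ⟨LinearMap.snd ℂ Poly E ∘ₗ G, by simp [h1], fun f => ?_, fun f => ?_⟩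
  · simp [hX, hX', hfst]
  · simp [hY, hY', hfst]

variable [NeZero d]

theorem el_add (S : Finset (ZMod d)) (f g : Poly) : el S f g = el S f 0 + el S 0 g := by
  simp [add_el]

/-- `P_S` is generated as a bimodule by its even and its odd generator. This is the proof principle
matching the recursion below. -/
theorem permFact_induction {S : Finset (ZMod d)} {p : permFact S → Prop} (t : permFact S)
    (even : p (el S 1 0)) (odd : p (el S 0 1)) (add : ∀ s t, p s → p t → p (s + t))
    (smul : ∀ (c : ℂ) t, p t → p (c • t)) (xl : ∀ t, p t → p ((permFact S).xl t))
    (xr : ∀ t, p t → p ((permFact S).xr t)) : p t := by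
  obtain ⟨f, g, rfl⟩ := exists_el _ t
  rw [el_add]
  refine add _ _ ?_ ?_
  · induction f using MvPolynomial.induction_on with
    | C c => simpa [smul_el, MvPolynomial.smul_eq_C_mul] using smul c _ even
    | add f g hf hg => simpa [add_el] using add _ _ hf hg
    | mul_X f i hf =>
      rw [mul_comm]
      fin_cases i
      · simpa using xl _ hf
      · simpa using xr _ hf
  · induction g using MvPolynomial.induction_on with
    | C c => simpa [smul_el, MvPolynomial.smul_eq_C_mul] using smul c _ odd
    | add f g hf hg => simpa [add_el] using add _ _ hf hg
    | mul_X f i hf =>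
      rw [mul_comm]
      fin_cases i
      · simpa using xl _ hf
      · simpa using xr _ hf

/-- Linear maps out of `P_S` that satisfy a recursion in both variables. -/
theorem exists_permFactRec {E : Type*} [AddCommGroup E] [Module ℂ E] (S : Finset (ZMod d))
    (X Y : Module.End ℂ E) (hXY : ∀ e, X (Y e) = Y (X e)) (a b : permFact S →ₗ[ℂ] E)
    (hab : ∀ t, a ((permFact S).xr t) + X (b t) = b ((permFact S).xl t) + Y (a t)) (e₀ e₁ : E) :
    ∃ F : permFact S →ₗ[ℂ] E, F (el S 1 0) = e₀ ∧ F (el S 0 1) = e₁ ∧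
      (∀ t, F ((permFact S).xl t) = X (F t) + a t) ∧
      ∀ t, F ((permFact S).xr t) = Y (F t) + b t := by
  let i₀ : Poly →ₗ[ℂ] permFact S := LinearMap.inl ℂ Poly Poly
  let i₁ : Poly →ₗ[ℂ] permFact S := LinearMap.inr ℂ Poly Poly
  have h₀ : ∀ f, i₀ f = el S f 0 := fun f => rfl
  have h₁ : ∀ f, i₁ f = el S 0 f := fun f => rfl
  obtain ⟨F, hF, hF0, hF1⟩ := exists_polyRec X Y hXY (a ∘ₗ i₀) (b ∘ₗ i₀)
    (fun f => by simpa [h₀] using hab (el S f 0)) e₀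
  obtain ⟨G, hG, hG0, hG1⟩ := exists_polyRec X Y hXY (a ∘ₗ i₁) (b ∘ₗ i₁)
    (fun f => by simpa [h₁] using hab (el S 0 f)) e₁
  let H : permFact S →ₗ[ℂ] E := (F.coprod G : Poly × Poly →ₗ[ℂ] E)
  have hH : ∀ f g, H (el S f g) = F f + G g := fun f g => rfl
  refine ⟨H, by simp [hH, hF], by simp [hH, hG], fun t => ?_, fun t => ?_⟩ <;>
    obtain ⟨f, g, rfl⟩ := exists_el _ t
  · rw [xl_el, hH, hH, hF0, hG0, el_add S f g]
    simp [h₀, h₁]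
    abel
  · rw [xr_el, hH, hH, hF1, hG1, el_add S f g]
    simp [h₀, h₁]
    abel

end

/-! ### Divided differences and polynomial actions -/

section

variable {d : ℕ}

/-- `f (x, y) ↦ f (t, t)` for one of the two variables `t`. -/
def diagTo (i : Fin 2) : Poly →ₐ[ℂ] Poly := MvPolynomial.aeval fun _ => MvPolynomial.X i

@[simp] theorem diagTo_X (i j : Fin 2) : diagTo i (MvPolynomial.X j) = MvPolynomial.X i := by
  simp [diagTo]

theorem euler_diagTo (i : Fin 2) (f : Poly) : euler (diagTo i f) = diagTo i (euler f) := by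
  induction f using MvPolynomial.induction_on with
  | C c => simp [diagTo, MvPolynomial.algebraMap_eq]
  | add f g hf hg => simp [hf, hg]
  | mul_X f j hf => simp [hf]

/-- Divided differences: `(f (x, y) - f (x, x)) / (y - x)`, or the same with `x` and `y`
exchanged. -/
theorem exists_divDiff (i j : Fin 2) (hij : i ≠ j) : ∃ δ : Poly →ₗ[ℂ] Poly, δ 1 = 0 ∧
    (∀ f, δ (MvPolynomial.X i * f) = MvPolynomial.X i * δ f) ∧
    (∀ f, δ (MvPolynomial.X j * f) = MvPolynomial.X j * δ f + diagTo i f) ∧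
    (∀ f, δ (euler f) = euler (δ f) + δ f) ∧
    ∀ f, (MvPolynomial.X j - MvPolynomial.X i) * δ f = f - diagTo i f := by
  -- Defining the divided difference by its recursion avoids division; the formula for the product
  -- with `X j - X i` follows by induction at the end.
  obtain ⟨δ, h1, hi, hj⟩ : ∃ δ : Poly →ₗ[ℂ] Poly, δ 1 = 0 ∧
      (∀ f, δ (MvPolynomial.X i * f) = MvPolynomial.X i * δ f) ∧
      (∀ f, δ (MvPolynomial.X j * f) = MvPolynomial.X j * δ f + diagTo i f) := by
    fin_cases i <;> fin_cases j
    · exact absurd rfl hij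
    · obtain ⟨δ, h1, h2, h3⟩ := exists_polyRec (E := Poly)
        (LinearMap.mulLeft ℂ (MvPolynomial.X 0)) (LinearMap.mulLeft ℂ (MvPolynomial.X 1))
        (fun e => by simp; ring) 0 (diagTo 0).toLinearMap (fun f => by simp) 0
      exact ⟨δ, h1, fun f => by simpa using h2 f, fun f => by simpa using h3 f⟩
    · obtain ⟨δ, h1, h2, h3⟩ := exists_polyRec (E := Poly)
        (LinearMap.mulLeft ℂ (MvPolynomial.X 0)) (LinearMap.mulLeft ℂ (MvPolynomial.X 1))
        (fun e => by simp; ring) (diagTo 1).toLinearMap 0 (fun f => by simp) 0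
      exact ⟨δ, h1, fun f => by simpa using h3 f, fun f => by simpa using h2 f⟩
    · exact absurd rfl hij
  have hC : ∀ c : ℂ, δ (MvPolynomial.C c) = 0 := fun c => by
    rw [← mul_one (MvPolynomial.C c), ← MvPolynomial.smul_eq_C_mul, map_smul, h1, smul_zero]
  have hcases : ∀ k : Fin 2, k = i ∨ k = j := by omega
  refine ⟨δ, h1, hi, hj, fun f => ?_, fun f => ?_⟩
  · induction f using MvPolynomial.induction_on with
    | C c => simp [hC]
    | add f g hf hg => simp only [map_add, hf, hg]; ring
    | mul_X f k hf =>
      rw [mul_comm]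
      rcases hcases k with rfl | rfl
      · simp [hi, hf, mul_comm _ (MvPolynomial.X k)]
        ring
      · simp [hj, hf, mul_comm f, euler_diagTo]; ring
  · induction f using MvPolynomial.induction_on with
    | C c => simp [hC, diagTo, MvPolynomial.algebraMap_eq]
    | add f g hf hg => simp only [map_add, mul_add, hf, hg]; ring
    | mul_X f k hf =>
      rw [mul_comm f]
      rcases hcases k with rfl | rfl
      · rw [hi, map_mul, diagTo_X]; linear_combination MvPolynomial.X k * hf
      · rw [hj, map_mul, diagTo_X]; linear_combination MvPolynomial.X k * hf

theorem actL_tmul (M N : Bifact d) (f : Poly) (m : M) (n : N) :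
    actL (M ⊙ N) f (m ⊗ₚ n) = actL M f m ⊗ₚ n := by
  induction f using MvPolynomial.induction_on generalizing m with
  | C c => simp
  | add f g hf hg => simp [hf, hg]
  | mul_X f i hf => simp [hf]

theorem actR_tmul (M N : Bifact d) (f : Poly) (m : M) (n : N) :
    actR (M ⊙ N) f (m ⊗ₚ n) = m ⊗ₚ actR N f n := by
  induction f using MvPolynomial.induction_on generalizing n with
  | C c => simp
  | add f g hf hg => simp [hf, hg]
  | mul_X f i hf => simp [hf]

variable [NeZero d]

theorem actL_el (S : Finset (ZMod d)) (f p q : Poly) :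
    actL (permFact S) f (el S p q) = el S (diagTo 0 f * p) (diagTo 0 f * q) := by
  induction f using MvPolynomial.induction_on generalizing p q with
  | C c => simp [diagTo, MvPolynomial.algebraMap_eq, smul_el, MvPolynomial.smul_eq_C_mul]
  | add f g hf hg => simp [hf, hg, add_el, add_mul]
  | mul_X f i hf => simp [hf, mul_assoc]

theorem actR_el (S : Finset (ZMod d)) (f p q : Poly) :
    actR (permFact S) f (el S p q) = el S (diagTo 1 f * p) (diagTo 1 f * q) := by
  induction f using MvPolynomial.induction_on generalizing p q with
  | C c => simp [diagTo, MvPolynomial.algebraMap_eq, smul_el, MvPolynomial.smul_eq_C_mul]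
  | add f g hf hg => simp [hf, hg, add_el, add_mul]
  | mul_X f i hf => simp [hf, mul_assoc]

end

/-! ### The left unitor is a homotopy equivalence -/

section

variable {d : ℕ} [NeZero d]

/-- The component of the differential of `P_S` from the odd to the even part. -/
def diffToEven (S : Finset (ZMod d)) : Module.End ℂ (permFact S) :=
  ((LinearMap.mulLeft ℂ (permProd S) ∘ₗ LinearMap.snd ℂ Poly Poly).prod 0 :
    Module.End ℂ (Poly × Poly))

/-- The component of the differential of `P_S` from the even to the odd part. -/
def diffToOdd (S : Finset (ZMod d)) : Module.End ℂ (permFact S) :=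
  ((0 : Poly × Poly →ₗ[ℂ] Poly).prod (LinearMap.mulLeft ℂ (permProd Sᶜ) ∘ₗ
    LinearMap.fst ℂ Poly Poly) : Module.End ℂ (Poly × Poly))

/-- The projection of `P_S` to its odd part. -/
def oddProj (S : Finset (ZMod d)) : Module.End ℂ (permFact S) :=
  ((0 : Poly × Poly →ₗ[ℂ] Poly).prod (LinearMap.snd ℂ Poly Poly) : Module.End ℂ (Poly × Poly))

section

variable (S : Finset (ZMod d)) (f g : Poly)

@[simp] theorem diffToEven_el : diffToEven S (el S f g) = el S (permProd S * g) 0 := rfl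
@[simp] theorem diffToOdd_el : diffToOdd S (el S f g) = el S 0 (permProd Sᶜ * f) := rfl
@[simp] theorem oddProj_el : oddProj S (el S f g) = el S 0 g := rfl
theorem neg_el : -el S f g = el S (-f) (-g) := rfl
theorem sub_el (f' g' : Poly) : el S f g - el S f' g' = el S (f - f') (g - g') := rfl
theorem el_zero : el S 0 0 = 0 := rfl

theorem permProd_zero : permProd {(0 : ZMod d)} = MvPolynomial.X 0 - MvPolynomial.X 1 := by
  simp [permProd]

end

/-- Presents the morphism by a chain map known only through its values on pure tensors. The other
`exists_` lemmas for structural morphisms serve the same purpose: composites can then be computed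
without unfolding definitions. -/
theorem exists_leftUnitor (M : Bifact d) : ∃ p : cycles (unitObj d ⊙ M) M,
    leftUnitor M = homMk p ∧ ∀ f g m, p.1 (el {0} f g ⊗ₚ m) = actL M f m :=
  ⟨_, rfl, fun f g m => by simp⟩

theorem exists_rightUnitor (M : Bifact d) : ∃ p : cycles (M ⊙ unitObj d) M,
    rightUnitor M = homMk p ∧ ∀ m f g, p.1 (m ⊗ₚ el {0} f g) = actR M f m :=
  ⟨_, rfl, fun m f g => by simp⟩

theorem zero_tmul {M N : Bifact d} (n : N) : (0 : M) ⊗ₚ n = 0 := by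
  simpa using smul_tmul (0 : ℂ) (0 : M) n

theorem tmul_zero {M N : Bifact d} (m : M) : m ⊗ₚ (0 : N) = 0 := map_zero (pureTensor M N m)

instance isIso_leftUnitor (S : Finset (ZMod d)) : IsIso (leftUnitor (permFact S)) := by
  obtain ⟨δ, -, δ0, δ1, δe, δd⟩ := exists_divDiff 0 1 (by decide)
  -- The obvious section `m ↦ 1 ⊗ m` is not left linear, because `1 ⊗ x m = y ⊗ m`. Instead `s` is
  -- the bilinear extension of its values on the two generators; it need not commute with the
  -- differentials.
  obtain ⟨s, s0, s1, sl, sr⟩ := exists_permFactRec S (unitObj d ⊙ permFact S).xl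
    (unitObj d ⊙ permFact S).xr (unitObj d ⊙ permFact S).xl_xr 0 0 (fun t => by simp)
    (el {0} 1 0 ⊗ₚ el S 1 0) (el {0} 1 0 ⊗ₚ el S 0 1)
  -- `Δ` measures the difference of the two sections: it is designed so that `A₁ (Δ m) = s m - 1 ⊗
  -- m`. Passing from `m` to `x m` changes that difference by `(x - y) ⊗ m`, the image under `A₁` of
  -- the odd generator tensored with `m`.
  obtain ⟨Δ, Δ0, Δ1, Δl, Δr⟩ := exists_permFactRec S (unitObj d ⊙ permFact S).xl
    (unitObj d ⊙ permFact S).xr (unitObj d ⊙ permFact S).xl_xr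
    (tmulL (unitObj d) (permFact S) (el {0} 0 1)) 0 (fun t => by simp) 0 0
  simp only [LinearMap.zero_apply, add_zero, tmulL_apply] at sl sr Δl Δr
  let odd : Poly →ₗ[ℂ] unitObj d := LinearMap.inr ℂ Poly Poly
  have odd_apply : ∀ f, odd f = el {0} 0 f := fun f => rfl
  -- On the even part of the unit, `δ` moves `f(x,y) ⊗ m` to `f(x,x) ⊗ m`, and `Δ` then moves this
  -- to `f(x,x) s m`. Separately neither term is balanced over the middle variable; the
  -- inhomogeneous terms of the recursions for `δ` and `Δ` agree and cancel in the comparison.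
  let h : (unitObj d ⊙ permFact S : Bifact d) →ₗ[ℂ] (unitObj d ⊙ permFact S : Bifact d) :=
    tensorLift (-(((actL (unitObj d ⊙ permFact S)).compl₂ Δ +
      (tmulL (unitObj d) (permFact S)) ∘ₗ odd ∘ₗ δ) ∘ₗ evenPart {0})) (fun t m => by
        obtain ⟨f, g, rfl⟩ := exists_el _ t
        have e : el {0} 0 (δ (MvPolynomial.X 1 * f)) ⊗ₚ m =
            el {0} 0 (MvPolynomial.X 1 * δ f) ⊗ₚ m + el {0} 0 (diagTo 0 f) ⊗ₚ m := by
          rw [δ1, ← add_tmul, add_el, add_zero]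
        simp [odd_apply, Δl, mul_comm _ f, actL_tmul, actL_el, ← xr_tmul]
        rw [mul_comm f, e]
        abel)
  have h_apply : ∀ f g m, h (el {0} f g ⊗ₚ m) =
      -(actL (unitObj d ⊙ permFact S) f (Δ m) + el {0} 0 (δ f) ⊗ₚ m) := fun f g m => by
    simp [h, odd_apply]
  -- The differential is split into the Koszul component `x - y` of the unit, the opposite component
  -- of the unit, and the differential of `P_S`. The projection `Q` is onto the odd part of the
  -- unit, where `h` takes its values and on which it vanishes.
  let A₁ : (unitObj d ⊙ permFact S : Bifact d) →ₗ[ℂ] (unitObj d ⊙ permFact S : Bifact d) :=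
    tensorMap (diffToEven {0}) LinearMap.id (fun t => by
      obtain ⟨f, g, rfl⟩ := exists_el _ t; simp [mul_left_comm]) (fun _ => rfl)
  let A₂ : (unitObj d ⊙ permFact S : Bifact d) →ₗ[ℂ] (unitObj d ⊙ permFact S : Bifact d) :=
    tensorMap (diffToOdd {0}) LinearMap.id (fun t => by
      obtain ⟨f, g, rfl⟩ := exists_el _ t; simp [mul_left_comm]) (fun _ => rfl)
  let B : (unitObj d ⊙ permFact S : Bifact d) →ₗ[ℂ] (unitObj d ⊙ permFact S : Bifact d) :=
    tensorMap (unitObj d).par (permFact S).diff (unitObj d).par_xr (permFact S).diff_xl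
  let Q : (unitObj d ⊙ permFact S : Bifact d) →ₗ[ℂ] (unitObj d ⊙ permFact S : Bifact d) :=
    tensorMap (oddProj {0}) LinearMap.id (fun t => by
      obtain ⟨f, g, rfl⟩ := exists_el _ t; simp) (fun _ => rfl)
  have A₁_apply : ∀ t m, A₁ (t ⊗ₚ m) = diffToEven {0} t ⊗ₚ m := fun t m => tensorMap_tmul ..
  have A₂_apply : ∀ t m, A₂ (t ⊗ₚ m) = diffToOdd {0} t ⊗ₚ m := fun t m => tensorMap_tmul ..
  have B_apply : ∀ t m, B (t ⊗ₚ m) = (unitObj d).par t ⊗ₚ (permFact S).diff m :=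
    fun t m => tensorMap_tmul ..
  have Q_apply : ∀ t m, Q (t ⊗ₚ m) = oddProj {0} t ⊗ₚ m := fun t m => tensorMap_tmul ..
  have A₁_xl : ∀ c, A₁ ((unitObj d ⊙ permFact S).xl c) = (unitObj d ⊙ permFact S).xl (A₁ c) := by
    intro c
    induction c using tensor_induction with
    | add c c' hc hc' => simp only [map_add, hc, hc']
    | tmul t m =>
      obtain ⟨f, g, rfl⟩ := exists_el _ t
      simp [A₁_apply, mul_left_comm]
  have A₁_xr : ∀ c, A₁ ((unitObj d ⊙ permFact S).xr c) = (unitObj d ⊙ permFact S).xr (A₁ c) := by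
    intro c
    induction c using tensor_induction with
    | add c c' hc hc' => simp only [map_add, hc, hc']
    | tmul t m => simp [A₁_apply]
  have Q_xl : ∀ c, Q ((unitObj d ⊙ permFact S).xl c) = (unitObj d ⊙ permFact S).xl (Q c) := by
    intro c
    induction c using tensor_induction with
    | add c c' hc hc' => simp only [map_add, hc, hc']
    | tmul t m =>
      obtain ⟨f, g, rfl⟩ := exists_el _ t
      simp [Q_apply]
  have Q_xr : ∀ c, Q ((unitObj d ⊙ permFact S).xr c) = (unitObj d ⊙ permFact S).xr (Q c) := by
    intro c
    induction c using tensor_induction with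
    | add c c' hc hc' => simp only [map_add, hc, hc']
    | tmul t m => simp [Q_apply]
  have QΔ : ∀ m, Q (Δ m) = Δ m := by
    intro m
    induction m using permFact_induction with
    | even => simp [Δ0]
    | odd => simp [Δ1]
    | add m m' hm hm' => simp only [map_add, hm, hm']
    | smul c m hm => simp only [map_smul, hm]
    | xl m hm => simp [Δl, Q_xl, hm, Q_apply]
    | xr m hm => simp [Δr, Q_xr, hm]
  have AΔ : ∀ m, A₁ (Δ m) = s m - el {0} 1 0 ⊗ₚ m := by
    intro m
    induction m using permFact_induction with
    | even => simp [Δ0, s0]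
    | odd => simp [Δ1, s1]
    | add m m' hm hm' => simp only [map_add, hm, hm', tmul_add]; abel
    | smul c m hm => simp only [map_smul, hm, tmul_smul, smul_sub]
    | xl m hm =>
      have e : el {0} (permProd {(0 : ZMod d)}) 0 ⊗ₚ m = el {0} (MvPolynomial.X 0) 0 ⊗ₚ m -
          el {0} (MvPolynomial.X 1) 0 ⊗ₚ m := by
        rw [← sub_tmul, sub_el, permProd_zero, sub_zero]
      simp [Δl, sl, A₁_xl, hm, A₁_apply, e, ← xr_tmul]
    | xr m hm => simp [Δr, sr, A₁_xr, hm]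
  have Δpar : ∀ m, Δ ((permFact S).par m) = -(unitObj d ⊙ permFact S).par (Δ m) := by
    intro m
    induction m using permFact_induction with
    | even => simp [Δ0]
    | odd =>
      have : el S 0 (-1) = -el S 0 1 := by simp [neg_el]
      simp [Δ1, this]
    | add m m' hm hm' => simp only [map_add, hm, hm']; abel
    | smul c m hm => simp only [map_smul, hm, smul_neg]
    | xl m hm =>
      have : el {(0 : ZMod d)} 0 (-1) = -el {0} 0 1 := by simp [neg_el]
      simp [(permFact S).par_xl, Δl, hm, (unitObj d ⊙ permFact S).par_xl, this, add_comm]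
    | xr m hm => simp [(permFact S).par_xr, Δr, hm, (unitObj d ⊙ permFact S).par_xr]
  have Δchg : ∀ m, (unitObj d ⊙ permFact S).chg (Δ m) = Δ ((permFact S).chg m) - Δ m := by
    intro m
    induction m using permFact_induction with
    | even =>
      have : (permFact S).chg (el S 1 0) = ((1 - S.card) / d : ℂ) • el S 1 0 := by
        simp [smul_el]
      rw [this]; simp [Δ0]
    | odd =>
      have : (permFact S).chg (el S 0 1) = ((S.card + 1) / d - 1 : ℂ) • el S 0 1 := by
        simp [smul_el]
      rw [this]; simp [Δ1]
    | add m m' hm hm' => simp only [map_add, hm, hm']; abel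
    | smul c m hm => simp only [map_smul, hm, smul_sub]
    | xl m hm =>
      have : (unitObj d).chg (el {0} 0 1) = (2 / d : ℂ) • el {0} 0 1 - el {0} 0 1 := by
        simp [smul_el, sub_el, sub_smul]; norm_num
      simp [(permFact S).chg_xl, Δl, hm, (unitObj d ⊙ permFact S).chg_xl, this]
      abel
    | xr m hm => simp [(permFact S).chg_xr, Δr, hm, (unitObj d ⊙ permFact S).chg_xr]; abel
  obtain ⟨p, hpp, hp⟩ := exists_leftUnitor (permFact S)
  have p1 := p.2.1
  have p2 := p.2.2.1
  rw [hpp]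
  have ext : ∀ {E : Type} [AddCommGroup E] [Module ℂ E]
      (F G : (unitObj d ⊙ permFact S : Bifact d) →ₗ[ℂ] E),
      (∀ f g m, F (el {0} f g ⊗ₚ m) = G (el {0} f g ⊗ₚ m)) → ∀ c, F c = G c := by
    intro E _ _ F G H c
    induction c using tensor_induction with
    | add c c' hc hc' => simp only [map_add, hc, hc']
    | tmul t m =>
      obtain ⟨f, g, rfl⟩ := exists_el _ t
      exact H f g m
  have Δxl : ∀ f m, actL (unitObj d ⊙ permFact S) f ((unitObj d ⊙ permFact S).xl (Δ m)) =
      (unitObj d ⊙ permFact S).xl (actL (unitObj d ⊙ permFact S) f (Δ m)) := fun f m =>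
    actL_comm (M := unitObj d ⊙ permFact S) (N := unitObj d ⊙ permFact S)
      (unitObj d ⊙ permFact S).xl (fun _ => rfl) f (Δ m)
  refine isIso_of_contraction p s h A₁ A₂ B Q ?_ sl sr ?_ ?_
    ?_ ?_ ?_ ?_ ?_ ?_ ?_ ?_ ?_ ?_ ?_ ?_ ?_ ?_ ?_
  · intro m
    induction m using permFact_induction with
    | even => simp [s0, hp, actL_el]
    | odd => simp [s1, hp, actL_el]
    | add m m' hm hm' => simp only [map_add, hm, hm']
    | smul c m hm => simp only [map_smul, hm]
    | xl m hm => rw [sl, p1, hm]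
    | xr m hm => rw [sr, p2, hm]
  · intro m
    induction m using permFact_induction with
    | even => simp [s0]
    | odd =>
      have : el S 0 (-1) = -el S 0 1 := by simp [neg_el]
      simp [s1, this]
    | add m m' hm hm' => simp only [map_add, hm, hm']
    | smul c m hm => simp only [map_smul, hm]
    | xl m hm => simp [(permFact S).par_xl, sl, hm, (unitObj d ⊙ permFact S).par_xl]
    | xr m hm => simp [(permFact S).par_xr, sr, hm, (unitObj d ⊙ permFact S).par_xr]
  · intro m
    have e : (unitObj d).chg (el {0} 1 0) = 0 := by simp [el_zero]
    induction m using permFact_induction with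
    | even =>
      have : (permFact S).chg (el S 1 0) = ((1 - S.card) / d : ℂ) • el S 1 0 := by
        simp [smul_el]
      rw [this, s0, map_smul, s0, chg_tmul, this, e, zero_tmul]; simp
    | odd =>
      have : (permFact S).chg (el S 0 1) = ((S.card + 1) / d - 1 : ℂ) • el S 0 1 := by
        simp [smul_el]
      rw [this, s1, map_smul, s1, chg_tmul, this, e, zero_tmul]; simp
    | add m m' hm hm' => simp only [map_add, hm, hm']
    | smul c m hm => simp only [map_smul, hm]
    | xl m hm => simp [(permFact S).chg_xl, sl, hm, (unitObj d ⊙ permFact S).chg_xl]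
    | xr m hm => simp [(permFact S).chg_xr, sr, hm, (unitObj d ⊙ permFact S).chg_xr]
  · refine ext (h ∘ₗ (unitObj d ⊙ permFact S).xl) ((unitObj d ⊙ permFact S).xl ∘ₗ h)
      fun f g m => ?_
    simp [h_apply, δ0, mul_comm _ f, Δxl]
    simp [mul_comm f, δ0]
  · refine ext (h ∘ₗ (unitObj d ⊙ permFact S).xr) ((unitObj d ⊙ permFact S).xr ∘ₗ h)
      fun f g m => ?_
    simp [h_apply, Δr, actL_comm (unitObj d ⊙ permFact S).xr
      (fun c => ((unitObj d ⊙ permFact S).xl_xr c).symm)]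
  · refine ext (h ∘ₗ (unitObj d ⊙ permFact S).par) (-(unitObj d ⊙ permFact S).par ∘ₗ h)
      fun f g m => ?_
    have : el {0} 0 (-δ f) = -el {(0 : ZMod d)} 0 (δ f) := by simp [neg_el]
    simp [h_apply, Δpar, actL_comm (unitObj d ⊙ permFact S).par
      (unitObj d ⊙ permFact S).par_xl, this]
    abel
  · refine ext ((unitObj d ⊙ permFact S).chg ∘ₗ h) (h ∘ₗ (unitObj d ⊙ permFact S).chg - h)
      fun f g m => ?_
    have : (unitObj d).chg (el {0} 0 (δ f)) = (2 / d : ℂ) • el {0} 0 (euler (δ f)) +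
        (2 / d : ℂ) • el {0} 0 (δ f) - el {0} 0 (δ f) := by
      simp [smul_el, sub_el, add_el, sub_smul]; norm_num; abel
    have e : el {0} 0 ((2 / d : ℂ) • euler (δ f) + (2 / d : ℂ) • δ f) =
        (2 / d : ℂ) • el {(0 : ZMod d)} 0 (euler (δ f)) + (2 / d : ℂ) • el {0} 0 (δ f) := by
      simp [smul_el, add_el]
    have e1 : (unitObj d).chg (el {0} f g) = el {0} ((2 / d : ℂ) • euler f) 
       ((2 / d : ℂ) • euler g + (2 / d - 1 : ℂ) • g) := by
      simp; norm_num
    simp only [LinearMap.comp_apply, LinearMap.sub_apply, chg_tmul, map_add, e1, h_apply,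
      map_neg, chg_actL, Δchg, this, δe, map_smul, smul_add, e]
    simp
    abel
  · refine ext (unitObj d ⊙ permFact S).diff (A₁ + A₂ + B) fun f g m => ?_
    simp only [diff_tmul, LinearMap.add_apply, A₁_apply, A₂_apply, B_apply, diffToEven_el,
      diffToOdd_el, diff_el, ← add_tmul, add_el, add_zero, zero_add]
  · refine ext (h ∘ₗ A₁ + A₁ ∘ₗ h) (LinearMap.id - s ∘ₗ p.1) fun f g m => ?_
    have e1 : δ (permProd {(0 : ZMod d)} * g) = -g := by
      rw [permProd_zero, sub_mul, map_sub, δ0, δ1]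
      linear_combination -δd g
    have e2 : permProd {(0 : ZMod d)} * δ f = diagTo 0 f - f := by
      rw [permProd_zero]
      linear_combination -δd f
    simp only [LinearMap.add_apply, LinearMap.comp_apply, LinearMap.sub_apply, LinearMap.id_apply,
      A₁_apply, diffToEven_el, h_apply, actL_unit, e1, hp, map_neg, map_add,
      ← actL_comm (M := unitObj d ⊙ permFact S) (N := unitObj d ⊙ permFact S) A₁ A₁_xl, AΔ, map_sub, actL_tmul, actL_el, e2, ← actL_comm (M := permFact S) (N := unitObj d ⊙ permFact S) s sl]
    have e3 : el {0} f g ⊗ₚ m = el {0} f 0 ⊗ₚ m + el {0} 0 g ⊗ₚ m := by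
      rw [← add_tmul, ← el_add]
    have e4 : el {0} 0 (-g) ⊗ₚ m = -el {(0 : ZMod d)} 0 g ⊗ₚ m := by
      rw [← neg_tmul, neg_el, neg_zero]
    have e5 : el {0} (diagTo 0 f - f) 0 ⊗ₚ m =
        el {(0 : ZMod d)} (diagTo 0 f) 0 ⊗ₚ m - el {0} f 0 ⊗ₚ m := by
      rw [← sub_tmul, sub_el, sub_zero]
    rw [e3, e4, e5, mul_one, mul_zero, LinearMap.zero_apply, zero_add]
    abel
  · refine ext (Q ∘ₗ h) h fun f g m => ?_
    simp only [LinearMap.comp_apply, h_apply, map_neg, map_add, ← actL_comm (M := unitObj d ⊙ permFact S) (N := unitObj d ⊙ permFact S) Q Q_xl, QΔ, Q_apply,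
      oddProj_el]
  · refine ext (h ∘ₗ Q) 0 fun f g m => ?_
    simp [Q_apply, h_apply, el_zero, zero_tmul]
  · refine ext (p.1 ∘ₗ Q) 0 fun f g m => ?_
    simp [Q_apply, hp]
  · refine ext (A₂ ∘ₗ Q) 0 fun f g m => ?_
    simp [Q_apply, A₂_apply, el_zero, zero_tmul]
  · refine ext (Q ∘ₗ A₂) A₂ fun f g m => ?_
    simp [Q_apply, A₂_apply]
  · refine ext (B ∘ₗ Q) (Q ∘ₗ B) fun f g m => ?_
    simp [Q_apply, B_apply]
  · refine ext (B ∘ₗ A₁ + A₁ ∘ₗ B) 0 fun f g m => ?_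
    simp [A₁_apply, B_apply, ← add_tmul, add_el, el_zero, zero_tmul]
  · refine ext (p.1 ∘ₗ A₁) 0 fun f g m => ?_
    simp [A₁_apply, hp, actL_unit]
  · refine ext (p.1 ∘ₗ B) ((permFact S).diff ∘ₗ p.1) fun f g m => ?_
    simp [B_apply, hp, actL_comm (permFact S).diff (permFact S).diff_xl]

end

/-! ### The right unitor is a homotopy equivalence -/

section

variable {d : ℕ} [NeZero d]

instance isIso_rightUnitor (S : Finset (ZMod d)) : IsIso (rightUnitor (permFact S)) := by
  obtain ⟨δ, -, δ1, δ0, δe, δd⟩ := exists_divDiff 1 0 (by decide)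
  obtain ⟨s, s0, s1, sl, sr⟩ := exists_permFactRec S (permFact S ⊙ unitObj d).xl
    (permFact S ⊙ unitObj d).xr (permFact S ⊙ unitObj d).xl_xr 0 0 (fun t => by simp)
    (el S 1 0 ⊗ₚ el {0} 1 0) (el S 0 1 ⊗ₚ el {0} 1 0)
  obtain ⟨Δ, Δ0, Δ1, Δl, Δr⟩ := exists_permFactRec S (permFact S ⊙ unitObj d).xl
    (permFact S ⊙ unitObj d).xr (permFact S ⊙ unitObj d).xl_xr 0
    ((tmulL (permFact S) (unitObj d)).flip (el {0} 0 1)) (fun t => by simp) 0 0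
  simp only [LinearMap.zero_apply, add_zero, tmulL_apply, LinearMap.flip_apply] at sl sr Δl Δr
  let odd : Poly →ₗ[ℂ] unitObj d := LinearMap.inr ℂ Poly Poly
  have odd_apply : ∀ f, odd f = el {0} 0 f := fun f => rfl
  -- The mirror image of the contraction for the left unitor, with divided differences towards
  -- `f(y,y)`. Here the differential of the unit passes the left factor with a Koszul sign, so `h`
  -- contains the parity operator of `P_S` to compensate for the one in `A₁`.
  let h : (permFact S ⊙ unitObj d : Bifact d) →ₗ[ℂ] (permFact S ⊙ unitObj d : Bifact d) :=
    tensorLift ((((actR (permFact S ⊙ unitObj d)).compl₂ Δ +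
      (tmulL (permFact S) (unitObj d)).flip ∘ₗ odd ∘ₗ δ) ∘ₗ evenPart {0}).flip ∘ₗ
        (permFact S).par) (fun m t => by
        obtain ⟨f, g, rfl⟩ := exists_el _ t
        have e : (permFact S).par m ⊗ₚ el {0} 0 (δ (MvPolynomial.X 0 * f)) =
            (permFact S).par m ⊗ₚ el {0} 0 (MvPolynomial.X 0 * δ f) +
              (permFact S).par m ⊗ₚ el {0} 0 (diagTo 1 f) := by
          rw [δ0, ← tmul_add, add_el, add_zero]
        simp [odd_apply, Δr, (permFact S).par_xr, mul_comm _ f, actR_tmul, actR_el, xr_tmul]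
        rw [mul_comm f, e]
        abel)
  have h_apply : ∀ m f g, h (m ⊗ₚ el {0} f g) =
      actR (permFact S ⊙ unitObj d) f (Δ ((permFact S).par m)) +
        (permFact S).par m ⊗ₚ el {0} 0 (δ f) := fun m f g => by
    simp [h, odd_apply]
  let A₁ : (permFact S ⊙ unitObj d : Bifact d) →ₗ[ℂ] (permFact S ⊙ unitObj d : Bifact d) :=
    tensorMap (permFact S).par (diffToEven {0}) (permFact S).par_xr (fun t => by
      obtain ⟨f, g, rfl⟩ := exists_el _ t; simp [mul_left_comm])
  let A₂ : (permFact S ⊙ unitObj d : Bifact d) →ₗ[ℂ] (permFact S ⊙ unitObj d : Bifact d) :=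
    tensorMap (permFact S).par (diffToOdd {0}) (permFact S).par_xr (fun t => by
      obtain ⟨f, g, rfl⟩ := exists_el _ t; simp [mul_left_comm])
  let B : (permFact S ⊙ unitObj d : Bifact d) →ₗ[ℂ] (permFact S ⊙ unitObj d : Bifact d) :=
    tensorMap (permFact S).diff LinearMap.id (permFact S).diff_xr (fun _ => rfl)
  let Q : (permFact S ⊙ unitObj d : Bifact d) →ₗ[ℂ] (permFact S ⊙ unitObj d : Bifact d) :=
    tensorMap LinearMap.id (oddProj {0}) (fun _ => rfl) (fun t => by
      obtain ⟨f, g, rfl⟩ := exists_el _ t; simp)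
  have A₁_apply : ∀ m t, A₁ (m ⊗ₚ t) = (permFact S).par m ⊗ₚ diffToEven {0} t :=
    fun m t => tensorMap_tmul ..
  have A₂_apply : ∀ m t, A₂ (m ⊗ₚ t) = (permFact S).par m ⊗ₚ diffToOdd {0} t :=
    fun m t => tensorMap_tmul ..
  have B_apply : ∀ m t, B (m ⊗ₚ t) = (permFact S).diff m ⊗ₚ t := fun m t => tensorMap_tmul ..
  have Q_apply : ∀ m t, Q (m ⊗ₚ t) = m ⊗ₚ oddProj {0} t := fun m t => tensorMap_tmul ..
  have ext : ∀ {E : Type} [AddCommGroup E] [Module ℂ E]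
      (F G : (permFact S ⊙ unitObj d : Bifact d) →ₗ[ℂ] E),
      (∀ m f g, F (m ⊗ₚ el {0} f g) = G (m ⊗ₚ el {0} f g)) → ∀ c, F c = G c := by
    intro E _ _ F G H c
    induction c using tensor_induction with
    | add c c' hc hc' => simp only [map_add, hc, hc']
    | tmul m t =>
      obtain ⟨f, g, rfl⟩ := exists_el _ t
      exact H m f g
  have A₁_xl : ∀ c, A₁ ((permFact S ⊙ unitObj d).xl c) = (permFact S ⊙ unitObj d).xl (A₁ c) :=
    ext (A₁ ∘ₗ (permFact S ⊙ unitObj d).xl) ((permFact S ⊙ unitObj d).xl ∘ₗ A₁)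
      fun m f g => by simp [A₁_apply, (permFact S).par_xl]
  have A₁_xr : ∀ c, A₁ ((permFact S ⊙ unitObj d).xr c) = (permFact S ⊙ unitObj d).xr (A₁ c) :=
    ext (A₁ ∘ₗ (permFact S ⊙ unitObj d).xr) ((permFact S ⊙ unitObj d).xr ∘ₗ A₁)
      fun m f g => by simp [A₁_apply, mul_left_comm]
  have Q_xl : ∀ c, Q ((permFact S ⊙ unitObj d).xl c) = (permFact S ⊙ unitObj d).xl (Q c) :=
    ext (Q ∘ₗ (permFact S ⊙ unitObj d).xl) ((permFact S ⊙ unitObj d).xl ∘ₗ Q)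
      fun m f g => by simp [Q_apply]
  have Q_xr : ∀ c, Q ((permFact S ⊙ unitObj d).xr c) = (permFact S ⊙ unitObj d).xr (Q c) :=
    ext (Q ∘ₗ (permFact S ⊙ unitObj d).xr) ((permFact S ⊙ unitObj d).xr ∘ₗ Q)
      fun m f g => by simp [Q_apply]
  have par0 : (permFact S).par (el S 1 0) = el S 1 0 := by simp
  have par1 : (permFact S).par (el S 0 1) = -el S 0 1 := by simp [neg_el]
  have QΔ : ∀ m, Q (Δ m) = Δ m := by
    intro m
    induction m using permFact_induction with
    | even => simp [Δ0]
    | odd => simp [Δ1]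
    | add m m' hm hm' => simp only [map_add, hm, hm']
    | smul c m hm => simp only [map_smul, hm]
    | xl m hm => simp [Δl, Q_xl, hm]
    | xr m hm => simp [Δr, Q_xr, hm, Q_apply]
  have AΔ : ∀ m, A₁ (Δ m) =
      (permFact S).par m ⊗ₚ el {0} 1 0 - s ((permFact S).par m) := by
    intro m
    induction m using permFact_induction with
    | even => rw [par0, Δ0, s0, sub_self, map_zero]
    | odd => rw [par1, Δ1, map_neg, s1, neg_tmul, sub_self, map_zero]
    | add m m' hm hm' => simp only [map_add, hm, hm', add_tmul]; abel
    | smul c m hm => simp only [map_smul, hm, smul_tmul, smul_sub]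
    | xl m hm => simp [Δl, A₁_xl, hm, (permFact S).par_xl, sl]
    | xr m hm =>
      have e : (permFact S).par m ⊗ₚ el {0} (permProd {(0 : ZMod d)}) 0 =
          (permFact S).par m ⊗ₚ el {0} (MvPolynomial.X 0) 0 -
          (permFact S).par m ⊗ₚ el {0} (MvPolynomial.X 1) 0 := by
        rw [← tmul_sub, sub_el, permProd_zero, sub_zero]
      simp [Δr, sr, A₁_xr, hm, A₁_apply, e, (permFact S).par_xr, xr_tmul]
  have Δpar : ∀ m, Δ ((permFact S).par m) = -(permFact S ⊙ unitObj d).par (Δ m) := by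
    intro m
    induction m using permFact_induction with
    | even => simp [Δ0]
    | odd => rw [par1, map_neg, Δ1, map_zero]
    | add m m' hm hm' => simp only [map_add, hm, hm']; abel
    | smul c m hm => simp only [map_smul, hm, smul_neg]
    | xl m hm => simp [(permFact S).par_xl, Δl, hm, (permFact S ⊙ unitObj d).par_xl]
    | xr m hm =>
      have : el {(0 : ZMod d)} 0 (-1) = -el {0} 0 1 := by simp [neg_el]
      simp [(permFact S).par_xr, Δr, hm, (permFact S ⊙ unitObj d).par_xr, this, add_comm]
  have chg0 : (permFact S).chg (el S 1 0) = ((1 - S.card) / d : ℂ) • el S 1 0 := by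
    simp [smul_el]
  have chg1 : (permFact S).chg (el S 0 1) = ((S.card + 1) / d - 1 : ℂ) • el S 0 1 := by
    simp [smul_el]
  have Δchg : ∀ m, (permFact S ⊙ unitObj d).chg (Δ m) = Δ ((permFact S).chg m) - Δ m := by
    intro m
    induction m using permFact_induction with
    | even => rw [chg0]; simp [Δ0]
    | odd => rw [chg1]; simp [Δ1]
    | add m m' hm hm' => simp only [map_add, hm, hm']; abel
    | smul c m hm => simp only [map_smul, hm, smul_sub]
    | xl m hm => simp [(permFact S).chg_xl, Δl, hm, (permFact S ⊙ unitObj d).chg_xl]; abel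
    | xr m hm =>
      have : (unitObj d).chg (el {0} 0 1) = (2 / d : ℂ) • el {0} 0 1 - el {0} 0 1 := by
        simp [smul_el, sub_el, sub_smul]; norm_num
      simp [(permFact S).chg_xr, Δr, hm, (permFact S ⊙ unitObj d).chg_xr, this]
      abel
  obtain ⟨p, hpp, hp⟩ := exists_rightUnitor (permFact S)
  have p1 := p.2.1
  have p2 := p.2.2.1
  rw [hpp]
  have actR_Δ (A : Module.End ℂ (permFact S ⊙ unitObj d : Bifact d))
      (hA : ∀ c, A ((permFact S ⊙ unitObj d).xr c) = (permFact S ⊙ unitObj d).xr (A c)) (f m) :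
      actR (permFact S ⊙ unitObj d) f (A (Δ m)) = A (actR (permFact S ⊙ unitObj d) f (Δ m)) :=
    actR_comm (M := permFact S ⊙ unitObj d) (N := permFact S ⊙ unitObj d) A hA f (Δ m)
  refine isIso_of_contraction p s h A₁ A₂ B Q ?_ sl sr ?_ ?_
    ?_ ?_ ?_ ?_ ?_ ?_ ?_ ?_ ?_ ?_ ?_ ?_ ?_ ?_ ?_
  · intro m
    induction m using permFact_induction with
    | even => simp [s0, hp, actR_el]
    | odd => simp [s1, hp, actR_el]
    | add m m' hm hm' => simp only [map_add, hm, hm']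
    | smul c m hm => simp only [map_smul, hm]
    | xl m hm => rw [sl, p1, hm]
    | xr m hm => rw [sr, p2, hm]
  · intro m
    induction m using permFact_induction with
    | even => simp [s0]
    | odd => rw [par1, map_neg, s1, par_tmul, par1, neg_tmul, par_el, neg_zero]
    | add m m' hm hm' => simp only [map_add, hm, hm']
    | smul c m hm => simp only [map_smul, hm]
    | xl m hm => simp [(permFact S).par_xl, sl, hm, (permFact S ⊙ unitObj d).par_xl]
    | xr m hm => simp [(permFact S).par_xr, sr, hm, (permFact S ⊙ unitObj d).par_xr]
  · intro m
    have e : (unitObj d).chg (el {0} 1 0) = 0 := by simp [el_zero]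
    induction m using permFact_induction with
    | even => rw [chg0, s0, map_smul, s0, chg_tmul, chg0, e, tmul_zero]; simp
    | odd => rw [chg1, s1, map_smul, s1, chg_tmul, chg1, e, tmul_zero]; simp
    | add m m' hm hm' => simp only [map_add, hm, hm']
    | smul c m hm => simp only [map_smul, hm]
    | xl m hm => simp [(permFact S).chg_xl, sl, hm, (permFact S ⊙ unitObj d).chg_xl]
    | xr m hm => simp [(permFact S).chg_xr, sr, hm, (permFact S ⊙ unitObj d).chg_xr]
  · refine ext (h ∘ₗ (permFact S ⊙ unitObj d).xl) ((permFact S ⊙ unitObj d).xl ∘ₗ h)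
      fun m f g => ?_
    simp [h_apply, (permFact S).par_xl, Δl, actR_Δ _ (permFact S ⊙ unitObj d).xl_xr]
  · refine ext (h ∘ₗ (permFact S ⊙ unitObj d).xr) ((permFact S ⊙ unitObj d).xr ∘ₗ h)
      fun m f g => ?_
    simp [h_apply, mul_comm _ f, actR_Δ _ (fun _ => rfl)]
    simp [mul_comm f, δ1]
  · refine ext (h ∘ₗ (permFact S ⊙ unitObj d).par) (-(permFact S ⊙ unitObj d).par ∘ₗ h)
      fun m f g => ?_
    have : el {0} 0 (-δ f) = -el {(0 : ZMod d)} 0 (δ f) := by simp [neg_el]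
    simp [h_apply, Δpar, actR_Δ _ (permFact S ⊙ unitObj d).par_xr, this,
      (permFact S ⊙ unitObj d).par_par, (permFact S).par_par]
    abel
  · refine ext ((permFact S ⊙ unitObj d).chg ∘ₗ h) (h ∘ₗ (permFact S ⊙ unitObj d).chg - h)
      fun m f g => ?_
    have : (unitObj d).chg (el {0} 0 (δ f)) = (2 / d : ℂ) • el {0} 0 (euler (δ f)) +
        (2 / d : ℂ) • el {0} 0 (δ f) - el {0} 0 (δ f) := by
      simp [smul_el, sub_el, add_el, sub_smul]; norm_num; abel
    have e : el {0} 0 ((2 / d : ℂ) • euler (δ f) + (2 / d : ℂ) • δ f) =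
        (2 / d : ℂ) • el {(0 : ZMod d)} 0 (euler (δ f)) + (2 / d : ℂ) • el {0} 0 (δ f) := by
      simp [smul_el, add_el]
    have e1 : (unitObj d).chg (el {0} f g) = el {0} ((2 / d : ℂ) • euler f)
        ((2 / d : ℂ) • euler g + (2 / d - 1 : ℂ) • g) := by
      simp; norm_num
    simp only [LinearMap.comp_apply, LinearMap.sub_apply, chg_tmul, map_add, e1, h_apply,
      map_neg, chg_actR, Δchg, this, δe, map_smul, smul_add, e, ← (permFact S).chg_par]
    simp
    abel
  · refine ext (permFact S ⊙ unitObj d).diff (A₁ + A₂ + B) fun m f g => ?_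
    simp only [diff_tmul, LinearMap.add_apply, A₁_apply, A₂_apply, B_apply, diffToEven_el,
      diffToOdd_el, diff_el, ← tmul_add, add_el, add_zero, zero_add]
    rw [add_comm]
  · refine ext (h ∘ₗ A₁ + A₁ ∘ₗ h) (LinearMap.id - s ∘ₗ p.1) fun m f g => ?_
    have e1 : δ (permProd {(0 : ZMod d)} * g) = g := by
      rw [permProd_zero, sub_mul, map_sub, δ0, δ1]
      linear_combination δd g
    have e2 : permProd {(0 : ZMod d)} * δ f = f - diagTo 1 f := by
      rw [permProd_zero]
      linear_combination δd f
    have e3 : m ⊗ₚ el {0} f g = m ⊗ₚ el {0} f 0 + m ⊗ₚ el {0} 0 g := by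
      rw [← tmul_add, ← el_add]
    have e5 : m ⊗ₚ el {0} (f - diagTo 1 f) 0 =
        m ⊗ₚ el {0} f 0 - m ⊗ₚ el {(0 : ZMod d)} (diagTo 1 f) 0 := by
      rw [← tmul_sub, sub_el, sub_zero]
    simp only [LinearMap.add_apply, LinearMap.comp_apply, LinearMap.sub_apply, LinearMap.id_apply,
      A₁_apply, diffToEven_el, h_apply, actR_unit, e1, hp, map_add, (permFact S).par_par,
      ← actR_Δ A₁ A₁_xr, AΔ, map_sub, actR_tmul, actR_el, e2,
      ← actR_comm (M := permFact S) (N := permFact S ⊙ unitObj d) s sr]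
    rw [e3, e5, mul_one, mul_zero, LinearMap.zero_apply, zero_add]
    abel
  · refine ext (Q ∘ₗ h) h fun m f g => ?_
    simp only [LinearMap.comp_apply, h_apply, map_add, ← actR_Δ Q Q_xr, QΔ, Q_apply, oddProj_el]
  · refine ext (h ∘ₗ Q) 0 fun m f g => ?_
    simp [Q_apply, h_apply, el_zero, tmul_zero]
  · refine ext (p.1 ∘ₗ Q) 0 fun m f g => ?_
    simp [Q_apply, hp]
  · refine ext (A₂ ∘ₗ Q) 0 fun m f g => ?_
    simp [Q_apply, A₂_apply, el_zero, tmul_zero]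
  · refine ext (Q ∘ₗ A₂) A₂ fun m f g => ?_
    simp [Q_apply, A₂_apply]
  · refine ext (B ∘ₗ Q) (Q ∘ₗ B) fun m f g => ?_
    simp [Q_apply, B_apply]
  · refine ext (B ∘ₗ A₁ + A₁ ∘ₗ B) 0 fun m f g => ?_
    simp [A₁_apply, B_apply, (permFact S).diff_par]
  · refine ext (p.1 ∘ₗ A₁) 0 fun m f g => ?_
    simp [A₁_apply, hp, actR_unit]
  · refine ext (p.1 ∘ₗ B) ((permFact S).diff ∘ₗ p.1) fun m f g => ?_
    simp [B_apply, hp, actR_comm (permFact S).diff (permFact S).diff_xr]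

end

/-! ### Functoriality of the tensor product and invertibility of `ψ` -/

section

variable {d : ℕ}

theorem exists_homMk {M N : Bifact d} (φ : M ⟶ N) : ∃ f, φ = homMk f := by
  obtain ⟨f⟩ := φ
  exact ⟨f, rfl⟩

theorem homMk_tensor {M M' N N' : Bifact d} (f : cycles M M') (g : cycles N N') :
    homMk f ⊙ₘ homMk g = homMk (cyclesTensor f g) := rfl

@[simp] theorem cyclesComp_apply {M N P : Bifact d} (f : cycles M N) (g : cycles N P) (m : M) :
    (cyclesComp f g).1 m = g.1 (f.1 m) := rfl

@[simp] theorem cyclesTensor_tmul {M M' N N' : Bifact d} (f : cycles M M') (g : cycles N N')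
    (m : M) (n : N) : (cyclesTensor f g).1 (m ⊗ₚ n) = f.1 m ⊗ₚ g.1 n :=
  tensorMap_tmul f.1 g.1 f.2.2.1 g.2.1 m n

/-- The identity chain map. -/
def cyclesId (M : Bifact d) : cycles M M := ⟨LinearMap.id, by refine ⟨?_, ?_, ?_, ?_, ?_⟩ <;> simp⟩

@[simp] theorem cyclesId_apply (M : Bifact d) (m : M) : (cyclesId M).1 m = m := rfl

theorem homMk_id (M : Bifact d) : 𝟙 M = homMk (cyclesId M) := rfl

theorem tensorHom_comp {M M' M'' N N' N'' : Bifact d} (f : M ⟶ M') (f' : M' ⟶ M'') (g : N ⟶ N')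
    (g' : N' ⟶ N'') : (f ⊙ₘ g) ≫ (f' ⊙ₘ g') = (f ≫ f') ⊙ₘ (g ≫ g') := by
  obtain ⟨f, rfl⟩ := exists_homMk f
  obtain ⟨f', rfl⟩ := exists_homMk f'
  obtain ⟨g, rfl⟩ := exists_homMk g
  obtain ⟨g', rfl⟩ := exists_homMk g'
  refine homMk_congr fun t => ?_
  induction t using tensor_induction with
  | add s t hs ht => simp only [map_add, hs, ht]
  | tmul m n => simp

theorem tensorHom_id (M N : Bifact d) : 𝟙 M ⊙ₘ 𝟙 N = 𝟙 (M ⊙ N) := by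
  refine homMk_congr fun t => ?_
  induction t using tensor_induction with
  | add s t hs ht => simp only [map_add, hs, ht]
  | tmul m n => exact cyclesTensor_tmul (cyclesId M) (cyclesId N) m n

instance {M M' N N' : Bifact d} (f : M ⟶ M') (g : N ⟶ N') [IsIso f] [IsIso g] :
    IsIso (f ⊙ₘ g) :=
  ⟨inv f ⊙ₘ inv g, by simp [tensorHom_comp, tensorHom_id], by simp [tensorHom_comp, tensorHom_id]⟩

variable [NeZero d]

theorem leftUnitor_naturality {M N : Bifact d} (φ : M ⟶ N) :
    (𝟙 (unitObj d) ⊙ₘ φ) ≫ leftUnitor N = leftUnitor M ≫ φ := by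
  obtain ⟨f, rfl⟩ := exists_homMk φ
  obtain ⟨p, hp, hp'⟩ := exists_leftUnitor M
  obtain ⟨q, hq, hq'⟩ := exists_leftUnitor N
  rw [hp, hq, homMk_id, homMk_tensor, homMk_comp, homMk_comp]
  refine homMk_congr fun t => ?_
  induction t using tensor_induction with
  | add s t hs ht => simp only [map_add, hs, ht]
  | tmul t m =>
    obtain ⟨u, v, rfl⟩ := exists_el _ t
    simp [hp', hq', actL_comm f.1 f.2.1]

theorem rightUnitor_naturality {M N : Bifact d} (φ : M ⟶ N) :
    (φ ⊙ₘ 𝟙 (unitObj d)) ≫ rightUnitor N = rightUnitor M ≫ φ := by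
  obtain ⟨f, rfl⟩ := exists_homMk φ
  obtain ⟨p, hp, hp'⟩ := exists_rightUnitor M
  obtain ⟨q, hq, hq'⟩ := exists_rightUnitor N
  rw [hp, hq, homMk_id, homMk_tensor, homMk_comp, homMk_comp]
  refine homMk_congr fun t => ?_
  induction t using tensor_induction with
  | add s t hs ht => simp only [map_add, hs, ht]
  | tmul m t =>
    obtain ⟨u, v, rfl⟩ := exists_el _ t
    simp [hp', hq', actR_comm f.1 f.2.2.1]

/-- `f (x, y) ↦ f (η ^ a t, t)`. -/
def lineEvalL (a : ZMod d) : Poly →ₐ[ℂ] Polynomial ℂ :=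
  MvPolynomial.aeval ![Polynomial.C (etaPow a) * Polynomial.X, Polynomial.X]

/-- `f (x, y) ↦ f (t, η ^ (-b) t)`. -/
def lineEvalR (b : ZMod d) : Poly →ₐ[ℂ] Polynomial ℂ :=
  MvPolynomial.aeval ![Polynomial.X, Polynomial.C (etaPow (-b)) * Polynomial.X]

/-- Both sides are algebra homomorphisms in `f`, so the two variables suffice. The twisted left
action sends both to `η^a x`, and the scaling by `η^{-a}` undoes this for `y`. -/
theorem actL_twist_scale (a : ZMod d) (M : Bifact d) (f : Poly) (m : M) :
    actL (twist (-a) 0 M) (scale (etaPow (-0 : ZMod d)) (etaPow (-a)) f) (toTwist _ _ M m) =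
      toTwist _ _ M (Polynomial.aeval M.xl (lineEvalL a f) m) := by
  have e : ((Polynomial.aeval (etaPow (- -a) • M.xl)).comp diagonal).comp
      (scale (etaPow (-0 : ZMod d)) (etaPow (-a))) = (Polynomial.aeval M.xl).comp (lineEvalL a) := by
    refine MvPolynomial.algHom_ext fun i => LinearMap.ext fun m => ?_
    fin_cases i
    · simp [lineEvalL, diagonal, Polynomial.aeval_C]
    · simp [lineEvalL, diagonal, Polynomial.aeval_C, smul_smul, ← AddChar.map_add_eq_mul]
  exact congrArg (fun k => k m) (congrArg (fun k => k f) e)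

theorem actR_twist_scale (b : ZMod d) (M : Bifact d) (f : Poly) (m : M) :
    actR (twist 0 (-b) M) (scale (etaPow (- -b)) (etaPow (0 : ZMod d)) f) (toTwist _ _ M m) =
      toTwist _ _ M (Polynomial.aeval M.xr (lineEvalR b f) m) := by
  have e : ((Polynomial.aeval (etaPow (-b) • M.xr)).comp diagonal).comp
      (scale (etaPow (- -b)) (etaPow (0 : ZMod d))) = (Polynomial.aeval M.xr).comp (lineEvalR b) := by
    refine MvPolynomial.algHom_ext fun i => LinearMap.ext fun m => ?_
    fin_cases i
    · simp [lineEvalR, diagonal, Polynomial.aeval_C, smul_smul, ← AddChar.map_add_eq_mul]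
    · simp [lineEvalR, diagonal, Polynomial.aeval_C]
  exact congrArg (fun k => k m) (congrArg (fun k => k f) e)

/-- The morphism `a M → _{-a} M` from `s_{0,-a}` and the left unitor. -/
def lineTwistL (a : ZMod d) (M : Bifact d) : line a ⊙ M ⟶ twist (-a) 0 M :=
  ((untwist 0 (-a) (S := {0}) (T := {a}) (by simp [shiftSet])).hom ⊙ₘ 𝟙 M) ≫
    (twistMiddle (-a) (unitObj d) M).hom ≫ leftUnitor (twist (-a) 0 M)

/-- The morphism `M b → M_{-b}` from `s_{-b,0}` and the right unitor. -/
def lineTwistR (b : ZMod d) (M : Bifact d) : M ⊙ line b ⟶ twist 0 (-b) M :=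
  (𝟙 M ⊙ₘ (untwist (-b) 0 (S := {0}) (T := {b}) (by simp [shiftSet])).hom) ≫
    (twistMiddle (-b) M (unitObj d)).inv ≫ rightUnitor (twist 0 (-b) M)

theorem exists_lineTwistL (a : ZMod d) (M : Bifact d) :
    ∃ p : cycles (line a ⊙ M) (twist (-a) 0 M), lineTwistL a M = homMk p ∧
      ∀ f g m, p.1 (el {a} f g ⊗ₚ m) =
        toTwist _ _ M (Polynomial.aeval M.xl (lineEvalL a f) m) := by
  refine ⟨_, rfl, fun f g m => ?_⟩
  rw [← actL_twist_scale]
  simp [cyclesComp, cyclesTensor]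

theorem exists_lineTwistR (b : ZMod d) (M : Bifact d) :
    ∃ p : cycles (M ⊙ line b) (twist 0 (-b) M), lineTwistR b M = homMk p ∧
      ∀ m f g, p.1 (m ⊗ₚ el {b} f g) =
        toTwist _ _ M (Polynomial.aeval M.xr (lineEvalR b f) m) := by
  refine ⟨_, rfl, fun m f g => ?_⟩
  rw [← actR_twist_scale]
  simp [cyclesComp, cyclesTensor]

/-- Naturality of the unitor moves the untwisting of `P_S` to the end. What precedes it makes sense
for every bifactorisation, not only for `P_S`. -/
theorem psiL_eq (a : ZMod d) {S T : Finset (ZMod d)} (h : T = shiftSet S a) :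
    psiL a h = lineTwistL a (permFact S) ≫
      (untwist (-a) 0 (S := S) (T := T) (by simpa using h)).inv := by
  rw [psiL, leftUnitor_naturality, lineTwistL, Category.assoc, Category.assoc]

theorem psiR_eq (b : ZMod d) {S T : Finset (ZMod d)} (h : T = shiftSet S b) :
    psiR b h = lineTwistR b (permFact S) ≫
      (untwist 0 (-b) (S := S) (T := T) (by simpa using h)).inv := by
  rw [psiR, rightUnitor_naturality, lineTwistR, Category.assoc, Category.assoc]

instance isIso_psiL (a : ZMod d) {S T : Finset (ZMod d)} (h : T = shiftSet S a) :
    IsIso (psiL a h) := by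
  unfold psiL; infer_instance

instance isIso_psiR (b : ZMod d) {S T : Finset (ZMod d)} (h : T = shiftSet S b) :
    IsIso (psiR b h) := by
  unfold psiR; infer_instance

/-- Read backwards from `psiL_eq`: the unitor occurring here is that of a twist, for which
invertibility is inherited from `ψ^L` and the untwisting. -/
instance (a : ZMod d) (S : Finset (ZMod d)) : IsIso (lineTwistL a (permFact S)) := by
  have e : lineTwistL a (permFact S) = psiL a rfl ≫
      (untwist (-a) 0 (S := S) (T := shiftSet S a) (by simp)).hom := by
    rw [psiL_eq, Category.assoc, Iso.inv_hom_id, Category.comp_id]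
  rw [e]
  infer_instance

instance (b : ZMod d) (S : Finset (ZMod d)) : IsIso (lineTwistR b (permFact S)) := by
  have e : lineTwistR b (permFact S) = psiR b rfl ≫
      (untwist 0 (-b) (S := S) (T := shiftSet S b) (by simp)).hom := by
    rw [psiR_eq, Category.assoc, Iso.inv_hom_id, Category.comp_id]
  rw [e]
  infer_instance

end

/-! ### Twists of tensor products -/

section

variable {d : ℕ}

theorem aeval_comm {E F : Type*} [AddCommGroup E] [Module ℂ E] [AddCommGroup F] [Module ℂ F]
    (A : E →ₗ[ℂ] F) (X : Module.End ℂ E) (Y : Module.End ℂ F) (hA : ∀ e, A (X e) = Y (A e))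
    (P : Polynomial ℂ) (e : E) : A (Polynomial.aeval X P e) = Polynomial.aeval Y P (A e) := by
  induction P using Polynomial.induction_on generalizing e with
  | C c => simp [Polynomial.aeval_C]
  | add P Q hP hQ => simp [hP, hQ]
  | monomial n c h =>
    have := h (X e)
    simp only [map_mul, map_pow, Polynomial.aeval_X, Polynomial.aeval_C, Module.End.mul_apply,
      pow_succ] at this ⊢
    rw [this, hA]

theorem aeval_xr_tmul {M N : Bifact d} (P : Polynomial ℂ) (m : M) (n : N) :
    Polynomial.aeval M.xr P m ⊗ₚ n = m ⊗ₚ Polynomial.aeval N.xl P n := by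
  induction P using Polynomial.induction_on' with
  | add P Q hP hQ => simp [hP, hQ]
  | monomial k c =>
    have : (M.xr ^ k) m ⊗ₚ n = m ⊗ₚ (N.xl ^ k) n := pureTensor_balanced_pow M N k m n
    simp [Polynomial.aeval_monomial, this]

variable [NeZero d]

/-- The map `_a M_b ⊗ _{-b} N_c → M N` which is the identity on pure tensors. -/
def untwistTensor (a b b' c : ZMod d) (h : b + b' = 0) (M N : Bifact d) :
    (twist a b M ⊙ twist b' c N : Bifact d) →ₗ[ℂ] (M ⊙ N : Bifact d) :=
  tensorLift ((tmulL M N).compl₁₂ (ofTwist a b M) (ofTwist b' c N)) (by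
      obtain rfl := neg_eq_of_add_eq_zero_right h
      intro t n
      obtain ⟨m, hm⟩ := exists_toTwist _ _ _ t
      obtain ⟨n, hn⟩ := exists_toTwist _ _ _ n
      rw [hm, hn]
      simp [xr_tmul])

@[simp] theorem untwistTensor_tmul (a b b' c : ZMod d) (h : b + b' = 0) (M N : Bifact d)
    (m : M) (n : N) :
    untwistTensor a b b' c h M N (toTwist a b M m ⊗ₚ toTwist b' c N n) = m ⊗ₚ n := by
  simp [untwistTensor]

/-- The map `M N → _a M_b ⊗ _{-b} N_c` which is the identity on pure tensors. -/
def intoTwistTensor (a b b' c : ZMod d) (h : b + b' = 0) (M N : Bifact d) :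
    (M ⊙ N : Bifact d) →ₗ[ℂ] (twist a b M ⊙ twist b' c N : Bifact d) :=
  tensorLift ((tmulL (twist a b M) (twist b' c N)).compl₁₂ (toTwist a b M) (toTwist b' c N)) (by
      obtain rfl := neg_eq_of_add_eq_zero_right h
      intro m n
      have h := xr_tmul (toTwist a b M m) (toTwist (-b) c N n)
      rw [xr_toTwist, smul_tmul, xl_toTwist, tmul_smul, neg_neg] at h
      have e : etaPow (-b) * etaPow b = 1 := by
        rw [← AddChar.map_add_eq_mul, neg_add_cancel, AddChar.map_zero_eq_one]
      have h' := congrArg (fun t => etaPow (-b) • t) h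
      simp only [smul_smul, e, one_smul] at h'
      exact h')

@[simp] theorem intoTwistTensor_tmul (a b b' c : ZMod d) (h : b + b' = 0) (M N : Bifact d)
    (m : M) (n : N) :
    intoTwistTensor a b b' c h M N (m ⊗ₚ n) = toTwist a b M m ⊗ₚ toTwist b' c N n := by
  simp [intoTwistTensor]

theorem twist_tensor_induction {a b b' c : ZMod d} {M N : Bifact d}
    {p : (twist a b M ⊙ twist b' c N : Bifact d) → Prop}
    (t : (twist a b M ⊙ twist b' c N : Bifact d))
    (tmul : ∀ m n, p (toTwist a b M m ⊗ₚ toTwist b' c N n))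
    (add : ∀ s t, p s → p t → p (s + t)) : p t :=
  tensor_induction t (fun m n => tmul (ofTwist a b M m) (ofTwist b' c N n)) add

theorem untwistTensor_intoTwistTensor (a b b' c : ZMod d) (h : b + b' = 0) (M N : Bifact d)
    (t : (M ⊙ N : Bifact d)) :
    untwistTensor a b b' c h M N (intoTwistTensor a b b' c h M N t) = t := by
  induction t using tensor_induction with
  | add s t hs ht => simp only [map_add, hs, ht]
  | tmul m n => rw [intoTwistTensor_tmul, untwistTensor_tmul]

theorem intoTwistTensor_untwistTensor (a b b' c : ZMod d) (h : b + b' = 0) (M N : Bifact d)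
    (t : (twist a b M ⊙ twist b' c N : Bifact d)) :
    intoTwistTensor a b b' c h M N (untwistTensor a b b' c h M N t) = t := by
  induction t using twist_tensor_induction with
  | add s t hs ht => simp only [map_add, hs, ht]
  | tmul m n => rw [untwistTensor_tmul, intoTwistTensor_tmul]

/-- The identification `_a M_b ⊗ _{-b} N_c = _a (M N)_c`, which is the identity on pure tensors. -/
def twistTensor (a b b' c : ZMod d) (h : b + b' = 0) (M N : Bifact d) :
    twist a b M ⊙ twist b' c N ≅ twist a c (M ⊙ N) :=
  isoMk
    ⟨toTwist a c (M ⊙ N) ∘ₗ untwistTensor a b b' c h M N, by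
      refine ⟨?_, ?_, ?_, ?_, ?_⟩ <;> intro t <;> induction t using twist_tensor_induction with
        | add s t hs ht => simp only [map_add, hs, ht]
        | tmul m n => simp⟩
    (intoTwistTensor a b b' c h M N ∘ₗ ofTwist a c (M ⊙ N))
    (intoTwistTensor_untwistTensor a b b' c h M N)
    (untwistTensor_intoTwistTensor a b b' c h M N)

theorem exists_twistTensor (a b b' c : ZMod d) (h : b + b' = 0) (M N : Bifact d) :
    ∃ p : cycles (twist a b M ⊙ twist b' c N) (twist a c (M ⊙ N)),
      (twistTensor a b b' c h M N).hom = homMk p ∧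
      ∀ m n, p.1 (toTwist a b M m ⊗ₚ toTwist b' c N n) = toTwist a c (M ⊙ N) (m ⊗ₚ n) :=
  ⟨_, rfl, fun m n => by simp⟩

/-- A chain map is also a chain map between twists. -/
def twistCycle (a b : ZMod d) {M N : Bifact d} (f : cycles M N) :
    cycles (twist a b M) (twist a b N) :=
  ⟨toTwist a b N ∘ₗ f.1 ∘ₗ ofTwist a b M, by
    obtain ⟨f, f1, f2, f3, f4, f5⟩ := f
    refine ⟨?_, ?_, ?_, ?_, ?_⟩ <;> intro t <;> obtain ⟨m, hm⟩ := exists_toTwist _ _ _ t <;>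
      rw [hm] <;> simp [f1, f2, f3, f4, f5]⟩

@[simp] theorem twistCycle_toTwist (a b : ZMod d) {M N : Bifact d} (f : cycles M N) (m : M) :
    (twistCycle a b f).1 (toTwist a b M m) = toTwist a b N (f.1 m) := rfl

theorem exists_associator (M N P : Bifact d) :
    ∃ p : cycles ((M ⊙ N) ⊙ P) (M ⊙ (N ⊙ P)), (associator M N P).hom = homMk p ∧
      ∀ m n q, p.1 ((m ⊗ₚ n) ⊗ₚ q) = m ⊗ₚ (n ⊗ₚ q) :=
  ⟨_, rfl, fun m n q => by simp⟩

theorem exists_associator_inv (M N P : Bifact d) :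
    ∃ p : cycles (M ⊙ (N ⊙ P)) ((M ⊙ N) ⊙ P), (associator M N P).inv = homMk p ∧
      ∀ m n q, p.1 (m ⊗ₚ (n ⊗ₚ q)) = (m ⊗ₚ n) ⊗ₚ q :=
  ⟨_, rfl, fun m n q => by simp⟩

/-- The morphism `a (M N) (-a) → _{-a} (M N)_a` that absorbs `a` into `M` and `-a` into `N`. -/
def conjTwist (a : ZMod d) (M N : Bifact d) :
    (line a ⊙ (M ⊙ N)) ⊙ line (-a) ⟶ twist (-a) (- -a) (M ⊙ N) :=
  ((associator (line a) M N).inv ⊙ₘ 𝟙 (line (-a))) ≫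
    (associator (line a ⊙ M) N (line (-a))).hom ≫
    (lineTwistL a M ⊙ₘ lineTwistR (-a) N) ≫ (twistTensor (-a) 0 0 (- -a) (add_zero 0) M N).hom

/-- The two lines are absorbed into different factors because `lineTwistL` and `lineTwistR` are
known to be invertible on each `P_S`, whereas the product `P_S P_T` is not of this form. -/
instance (a : ZMod d) (S T : Finset (ZMod d)) :
    IsIso (conjTwist a (permFact S) (permFact T)) := by
  unfold conjTwist; infer_instance

theorem exists_conjTwist (a : ZMod d) (M N : Bifact d) :
    ∃ p : cycles ((line a ⊙ (M ⊙ N)) ⊙ line (-a)) (twist (-a) (- -a) (M ⊙ N)),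
      conjTwist a M N = homMk p ∧ ∀ f g m n f' g', 
        p.1 ((el {a} f g ⊗ₚ (m ⊗ₚ n)) ⊗ₚ el {-a} f' g') = toTwist _ _ _
          (Polynomial.aeval M.xl (lineEvalL a f) m ⊗ₚ
            Polynomial.aeval N.xr (lineEvalR (-a) f') n) := by
  obtain ⟨p, hp, hp'⟩ := exists_associator_inv (line a) M N
  obtain ⟨q, hq, hq'⟩ := exists_associator (line a ⊙ M) N (line (-a))
  obtain ⟨l, hl, hl'⟩ := exists_lineTwistL a M
  obtain ⟨r, hr, hr'⟩ := exists_lineTwistR (-a) N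
  obtain ⟨t, ht, ht'⟩ := exists_twistTensor (-a) 0 0 (- -a) (add_zero 0) M N
  rw [conjTwist, hp, hq, hl, hr, ht, homMk_id, homMk_tensor, homMk_tensor, homMk_comp, homMk_comp,
    homMk_comp]
  exact ⟨_, rfl, fun f g m n f' g' => by simp [hp', hq', hl', hr', ht']⟩

end

/-! ### Explicit formulas for fusion, evaluation and the cap -/

section

variable {d : ℕ} [NeZero d]

theorem scale_comp (u v u' v' : ℂ) (f : Poly) :
    scale u v (scale u' v' f) = scale (u * u') (v * v') f := by
  have e : ((scale u v).comp (scale u' v')) = scale (u * u') (v * v') := by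
    refine MvPolynomial.algHom_ext fun i => ?_
    fin_cases i <;> simp <;> ring
  exact congrArg (fun k => k f) e

theorem scale_one (f : Poly) : scale 1 1 f = f := by
  have e : scale 1 1 = AlgHom.id ℂ Poly := by
    refine MvPolynomial.algHom_ext fun i => ?_
    fin_cases i <;> simp
  exact congrArg (fun k => k f) e

theorem exists_untwist (a b : ZMod d) {S T : Finset (ZMod d)} (h : T = shiftSet S (-a - b)) :
    ∃ p : cycles (permFact T) (twist a b (permFact S)), (untwist a b h).hom = homMk p ∧
      ∀ f g, p.1 (el T f g) = toTwist a b _ (el S (scale (etaPow (-a)) (etaPow b) f)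
        (etaPow (-((S.card : ZMod d) * a)) • scale (etaPow (-a)) (etaPow b) g)) :=
  ⟨_, rfl, fun f g => by simp⟩

theorem exists_untwist_inv (a b : ZMod d) {S T : Finset (ZMod d)} (h : T = shiftSet S (-a - b)) :
    ∃ p : cycles (twist a b (permFact S)) (permFact T), (untwist a b h).inv = homMk p ∧
      ∀ f g, p.1 (toTwist a b _ (el S f g)) = el T (scale (etaPow a) (etaPow (-b)) f)
        (etaPow ((S.card : ZMod d) * a) • scale (etaPow a) (etaPow (-b)) g) :=
  ⟨_, rfl, fun f g => by simp⟩

/-- The isomorphism `P_S → _{-a} (P_S)_a`. -/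
def selfTwist (a : ZMod d) (S : Finset (ZMod d)) : permFact S ≅ twist (-a) (- -a) (permFact S) :=
  untwist (-a) (- -a) (S := S) (T := S) (by simp [shiftSet])

/-- After the appended `s_{-a,a}` no scaling remains: fusing from both sides merely lets the two
lines act on `m`. This is the description of `κ^L` used for the comparison. -/
theorem exists_psiL_psiR (a : ZMod d) (S : Finset (ZMod d)) :
    ∃ p : cycles ((line a ⊙ permFact S) ⊙ line (-a)) (twist (-a) (- -a) (permFact S)),
      (psiL a (S := S) (T := shiftSet S a) rfl ⊙ₘ 𝟙 (line (-a))) ≫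
        psiR (-a) (S := shiftSet S a) (T := S) (shiftSet_neg S a) ≫ (selfTwist a S).hom =
          homMk p ∧
      ∀ f g m f' g', p.1 ((el {a} f g ⊗ₚ m) ⊗ₚ el {-a} f' g') =
        toTwist _ _ _ (Polynomial.aeval (permFact S).xr (lineEvalR (-a) f')
          (Polynomial.aeval (permFact S).xl (lineEvalL a f) m)) := by
  obtain ⟨l, hl, hl'⟩ := exists_lineTwistL a (permFact S)
  obtain ⟨r, hr, hr'⟩ := exists_lineTwistR (-a) (permFact (shiftSet S a))
  obtain ⟨z, hz, hz'⟩ := exists_untwist_inv (-a) 0 (S := S) (T := shiftSet S a) (by simp)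
  obtain ⟨w, hw, hw'⟩ := exists_untwist_inv 0 (- -a) (S := shiftSet S a) (T := S)
    (by simpa using shiftSet_neg S a)
  obtain ⟨s, hs, hs'⟩ := exists_untwist (-a) (- -a) (S := S) (T := S) (by simp [shiftSet])
  rw [psiL_eq, psiR_eq, selfTwist, hl, hr, hz, hw, hs, homMk_comp, homMk_id, homMk_tensor,
    homMk_comp, homMk_comp, homMk_comp]
  refine ⟨_, rfl, fun f g m f' g' => ?_⟩
  -- The inverses of `s_{-a,0}` and `s_{0,a}` rescale `x` and `y` by `η^{-a}`, and `s_{-a,a}`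
  -- rescales both by `η^a`. The factors on the odd part cancel too, as a translate of `S` has the
  -- same cardinality.
  have key : ∀ m : permFact S, s.1 (w.1 (toTwist _ _ _ (z.1 (toTwist _ _ _ m)))) =
      toTwist _ _ _ m := by
    intro m
    obtain ⟨p, q, rfl⟩ := exists_el _ m
    simp only [hz', hw', hs', scale_comp, map_smul, smul_smul, ← AddChar.map_add_eq_mul,
      card_shiftSet]
    simp [scale_one]
  have zr : ∀ m : permFact S, (z.1 ∘ₗ toTwist (-a) 0 (permFact S)) ((permFact S).xr m) =
      (permFact (shiftSet S a)).xr ((z.1 ∘ₗ toTwist (-a) 0 (permFact S)) m) := by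
    intro m
    have := z.2.2.1 (toTwist _ _ _ m)
    simpa using this
  have zr' := aeval_comm (z.1 ∘ₗ toTwist (-a) 0 (permFact S)) _ _ zr
  simp only [LinearMap.comp_apply] at zr'
  simp [hl', hr', ← zr', key]

/-- The counterpart for `κ^R`, with the right line fused first. That both orders give the same
action is what lets one map `s_{-a,a}` serve for both legs. -/
theorem exists_psiR_psiL (a : ZMod d) (S : Finset (ZMod d)) :
    ∃ p : cycles (line a ⊙ (permFact S ⊙ line (-a))) (twist (-a) (- -a) (permFact S)),
      (𝟙 (line a) ⊙ₘ psiR (-a) (S := S) (T := shiftSet S (-a)) rfl) ≫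
        psiL a (S := shiftSet S (-a)) (T := S) (shiftSet_neg' S a) ≫ (selfTwist a S).hom =
          homMk p ∧
      ∀ f g m f' g', p.1 (el {a} f g ⊗ₚ (m ⊗ₚ el {-a} f' g')) =
        toTwist _ _ _ (Polynomial.aeval (permFact S).xl (lineEvalL a f)
          (Polynomial.aeval (permFact S).xr (lineEvalR (-a) f') m)) := by
  obtain ⟨l, hl, hl'⟩ := exists_lineTwistL a (permFact (shiftSet S (-a)))
  obtain ⟨r, hr, hr'⟩ := exists_lineTwistR (-a) (permFact S)
  obtain ⟨z, hz, hz'⟩ := exists_untwist_inv (-a) 0 (S := shiftSet S (-a)) (T := S)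
    (by simpa using shiftSet_neg' S a)
  obtain ⟨w, hw, hw'⟩ := exists_untwist_inv 0 (- -a) (S := S) (T := shiftSet S (-a))
    (by simp)
  obtain ⟨s, hs, hs'⟩ := exists_untwist (-a) (- -a) (S := S) (T := S) (by simp [shiftSet])
  rw [psiL_eq, psiR_eq, selfTwist, hl, hr, hz, hw, hs, homMk_comp, homMk_id, homMk_tensor,
    homMk_comp, homMk_comp, homMk_comp]
  refine ⟨_, rfl, fun f g m f' g' => ?_⟩
  have key : ∀ m : permFact S, s.1 (z.1 (toTwist _ _ _ (w.1 (toTwist _ _ _ m)))) =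
      toTwist _ _ _ m := by
    intro m
    obtain ⟨p, q, rfl⟩ := exists_el _ m
    simp only [hz', hw', hs', scale_comp, map_smul, smul_smul, ← AddChar.map_add_eq_mul,
      card_shiftSet]
    simp [scale_one]
  have wl : ∀ m : permFact S, (w.1 ∘ₗ toTwist 0 (- -a) (permFact S)) ((permFact S).xl m) =
      (permFact (shiftSet S (-a))).xl ((w.1 ∘ₗ toTwist 0 (- -a) (permFact S)) m) := by
    intro m
    have := w.2.1 (toTwist _ _ _ m)
    simpa using this
  have wl' := aeval_comm (w.1 ∘ₗ toTwist 0 (- -a) (permFact S)) _ _ wl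
  simp only [LinearMap.comp_apply] at wl'
  simp [hl', hr', ← wl', key]

theorem aeval_xl_el (S : Finset (ZMod d)) (P : Polynomial ℂ) (f g : Poly) :
    Polynomial.aeval (permFact S).xl P (el S f g) =
      el S (Polynomial.aeval (MvPolynomial.X 0 : Poly) P * f)
        (Polynomial.aeval (MvPolynomial.X 0 : Poly) P * g) := by
  induction P using Polynomial.induction_on generalizing f g with
  | C c =>
    simp [Polynomial.aeval_C, smul_el, MvPolynomial.smul_eq_C_mul, MvPolynomial.algebraMap_eq]
  | add P Q hP hQ => simp [hP, hQ, add_el, add_mul]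
  | monomial n c h =>
    have := h (MvPolynomial.X 0 * f) (MvPolynomial.X 0 * g)
    rw [← xl_el] at this
    simp only [map_mul, map_pow, Polynomial.aeval_X, Polynomial.aeval_C, Module.End.mul_apply,
      pow_succ, mul_assoc] at this ⊢
    exact this

theorem lineEvalL_aeval (a : ZMod d) (f f' : Poly) :
    diagonal (scale (etaPow (- -a)) (etaPow (-0 : ZMod d))
      (Polynomial.aeval (MvPolynomial.X 0 : Poly) (lineEvalL (-a) f) * f')) =
      lineEvalR (-a) f * lineEvalL a f' := by
  have e1 : diagonal.comp (scale (etaPow (- -a)) (etaPow (-0 : ZMod d))) = lineEvalL a := by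
    refine MvPolynomial.algHom_ext fun i => ?_
    fin_cases i <;> simp [diagonal, lineEvalL, MvPolynomial.algebraMap_eq]
  have e2 : ((lineEvalL a).comp (Polynomial.aeval (MvPolynomial.X 0 : Poly))).comp
      (lineEvalL (-a)) = lineEvalR (-a) := by
    refine MvPolynomial.algHom_ext fun i => ?_
    fin_cases i
    · have e : etaPow (-a) * etaPow a = 1 := by
        rw [← AddChar.map_add_eq_mul, neg_add_cancel, AddChar.map_zero_eq_one]
      simp [lineEvalR, lineEvalL]
      rw [← mul_assoc, ← Polynomial.C_mul, e, Polynomial.C_1, one_mul]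
    · simp [lineEvalR, lineEvalL]
  rw [map_mul, map_mul]
  have e1' := fun f => congrArg (fun k => k f) e1
  have e2' := fun f => congrArg (fun k => k f) e2
  simp only [AlgHom.comp_apply] at e1' e2'
  rw [e1', e1', e2']

/-- Only the even part restricted to the diagonal is recorded, since the left unitor that follows
the evaluation in the cap sees nothing else. There the two factors are `f(t, η^a t)` and `f'(η^a t,
t)`. -/
theorem exists_ev (a : ZMod d) : ∃ p : cycles (line (-a) ⊙ line a) (unitObj d), ev a = homMk p ∧
    ∀ f g f' g', diagonal (evenPart {0} (p.1 (el {-a} f g ⊗ₚ el {a} f' g'))) =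
      lineEvalR (-a) f * lineEvalL a f' := by
  obtain ⟨l, hl, hl'⟩ := exists_lineTwistL (-a) (line a)
  obtain ⟨z, hz, hz'⟩ := exists_untwist_inv (- -a) 0 (S := {a}) (T := {0}) (by simp [shiftSet])
  rw [ev, psiL_eq, hl, hz, homMk_comp]
  refine ⟨_, rfl, fun f g f' g' => ?_⟩
  rw [cyclesComp_apply, hl', aeval_xl_el, hz', evenPart_el, lineEvalL_aeval]

theorem exists_cap (a : ZMod d) (M N : Bifact d) :
    ∃ p : cycles (((line a ⊙ M) ⊙ line (-a)) ⊙ (line a ⊙ (N ⊙ line (-a))))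
      ((line a ⊙ (M ⊙ N)) ⊙ line (-a)), cap a M N = homMk p ∧
      ∀ u m f g f' g' n v, p.1 (((u ⊗ₚ m) ⊗ₚ el {-a} f g) ⊗ₚ (el {a} f' g' ⊗ₚ (n ⊗ₚ v))) =
        (u ⊗ₚ (m ⊗ₚ Polynomial.aeval N.xl (lineEvalR (-a) f * lineEvalL a f') n)) ⊗ₚ v := by
  obtain ⟨p₁, h₁, h₁'⟩ := exists_associator (line a ⊙ M) (line (-a)) (line a ⊙ (N ⊙ line (-a)))
  obtain ⟨p₂, h₂, h₂'⟩ := exists_associator_inv (line (-a)) (line a) (N ⊙ line (-a))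
  obtain ⟨p₃, h₃, h₃'⟩ := exists_ev a
  obtain ⟨p₄, h₄, h₄'⟩ := exists_leftUnitor (N ⊙ line (-a))
  obtain ⟨p₅, h₅, h₅'⟩ := exists_associator_inv (line a ⊙ M) N (line (-a))
  obtain ⟨p₆, h₆, h₆'⟩ := exists_associator (line a) M N
  rw [cap, h₁, h₂, h₃, h₄, h₅, h₆]
  refine ⟨_, rfl, fun u m f g f' g' n v => ?_⟩
  have key : p₄.1 (p₃.1 (el {-a} f g ⊗ₚ el {a} f' g') ⊗ₚ (n ⊗ₚ v)) =
      Polynomial.aeval N.xl (lineEvalR (-a) f * lineEvalL a f') n ⊗ₚ v := by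
    rw [← h₃' f g f' g']
    obtain ⟨p, q, h⟩ := exists_el _ (p₃.1 (el {-a} f g ⊗ₚ el {a} f' g'))
    rw [h, h₄', evenPart_el, actL_tmul]
    rfl
  change (cyclesComp p₁ (cyclesComp (cyclesTensor (cyclesId _) (cyclesComp p₂ (cyclesComp
    (cyclesTensor p₃ (cyclesId _)) p₄))) (cyclesComp p₅ (cyclesTensor p₆ (cyclesId _))))).1 _ = _
  simp only [cyclesComp_apply, h₁', cyclesTensor_tmul, cyclesId_apply, h₂', key, h₅', h₆']

end

/-! ### Untwisting as a function of the charge -/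

section

variable {d : ℕ} [NeZero d]

theorem smul_homMk {M N : Bifact d} (c : ℂ) (f : cycles M N) : c • homMk f = homMk (c • f) := rfl

theorem smul_comp_eq {M N P : Bifact d} (c : ℂ) (φ : M ⟶ N) (ψ : N ⟶ P) :
    (c • φ) ≫ ψ = c • (φ ≫ ψ) := by
  obtain ⟨f, rfl⟩ := exists_homMk φ
  obtain ⟨g, rfl⟩ := exists_homMk ψ
  rw [smul_homMk, homMk_comp, homMk_comp, smul_homMk]
  exact homMk_congr fun m => map_smul g.1 c (f.1 m)

/-- `G` acts as the scalar `g q` on the part of charge `q`. -/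
def ActsByCharge (M : Bifact d) (G : Module.End ℂ M) (g : ℂ → ℂ) : Prop :=
  ∀ q m, M.chg m = q • m → G m = g q • m

/-- Eigenspaces of the charge are independent. If `m` of charge `q` is split along the given
decomposition, the components of other charges add up to an element that also has charge `q`, hence
to zero. It therefore suffices to check `G` on a spanning set of homogeneous elements. -/
theorem actsByCharge_of_iSup {M : Bifact d} {G : Module.End ℂ M} {g : ℂ → ℂ}
    (h : ⨆ q, M.chg.eigenspace q ⊓ G.eigenspace (g q) = ⊤) : ActsByCharge M G g := by
  intro q m hm
  have hm' : m ∈ M.chg.eigenspace q := Module.End.mem_eigenspace_iff.2 hm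
  have hle : ∀ p, M.chg.eigenspace p ⊓ G.eigenspace (g p) ≤ M.chg.eigenspace p :=
    fun p => inf_le_left
  have htop : m ∈ (M.chg.eigenspace q ⊓ G.eigenspace (g q)) ⊔
      ⨆ p ≠ q, M.chg.eigenspace p ⊓ G.eigenspace (g p) := by
    have := iSup_split_single (fun p => M.chg.eigenspace p ⊓ G.eigenspace (g p)) q
    rw [h] at this
    rw [← this]
    trivial
  obtain ⟨w, hw, z, hz, rfl⟩ := Submodule.mem_sup.1 htop
  have hz' : z ∈ ⨆ p ≠ q, M.chg.eigenspace p := iSup₂_mono (fun p _ => hle p) hz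
  have hz'' : z ∈ M.chg.eigenspace q := by
    have := sub_mem hm' (hle q hw)
    rwa [add_sub_cancel_left] at this
  have h0 := Submodule.disjoint_def.1 (M.chg.eigenspaces_iSupIndep q) z hz'' hz'
  rw [h0, add_zero]
  exact Module.End.mem_eigenspace_iff.1 hw.2

theorem ActsByCharge.tensor {M N : Bifact d} {G : Module.End ℂ M} {G' : Module.End ℂ N}
    {g g' g'' : ℂ → ℂ} (hG : ActsByCharge M G g) (hG' : ActsByCharge N G' g')
    (hg : ∀ p q, g p * g' q = g'' (p + q)) (F : Module.End ℂ (M ⊙ N : Bifact d))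
    (hF : ∀ m n, F (m ⊗ₚ n) = G m ⊗ₚ G' n) : ActsByCharge (M ⊙ N) F g'' := by
  refine actsByCharge_of_iSup (eq_top_iff.2 ?_)
  rintro t -
  induction t using tensor_induction with
  | add s t hs ht => exact add_mem hs ht
  | tmul m n =>
    have hm : m ∈ ⨆ q : ℂ, M.chg.eigenspace q := by rw [M.chg_diagonalisable]; trivial
    have hn : n ∈ ⨆ q : ℂ, N.chg.eigenspace q := by rw [N.chg_diagonalisable]; trivial
    induction hm using Submodule.iSup_induction' with
    | zero => rw [zero_tmul]; exact zero_mem _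
    | add a b _ _ ha hb => rw [add_tmul]; exact add_mem ha hb
    | mem p m hm =>
      induction hn using Submodule.iSup_induction' with
      | zero => rw [tmul_zero]; exact zero_mem _
      | add a b _ _ ha hb => rw [tmul_add]; exact add_mem ha hb
      | mem q n hn =>
        rw [Module.End.mem_eigenspace_iff] at hm hn
        refine Submodule.mem_iSup_of_mem (p + q) ⟨Module.End.mem_eigenspace_iff.2 ?_,
          Module.End.mem_eigenspace_iff.2 ?_⟩
        · simp [hm, hn, add_smul]
        · rw [hF, hG p m hm, hG' q n hn, ← hg, smul_tmul, tmul_smul, smul_smul]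

theorem scale_monomial (u : ℂ) (m : Fin 2 →₀ ℕ) (c : ℂ) :
    scale u u (MvPolynomial.monomial m c) = u ^ (m 0 + m 1) • MvPolynomial.monomial m c := by
  rw [MvPolynomial.monomial_eq, Finsupp.prod_fintype _ _ (by simp), Fin.prod_univ_two]
  simp [mul_pow, MvPolynomial.smul_eq_C_mul, pow_add]
  ring

theorem par_pow_tmul {M N : Bifact d} (k : ℕ) (m : M) (n : N) :
    ((M ⊙ N).par ^ k) (m ⊗ₚ n) = (M.par ^ k) m ⊗ₚ (N.par ^ k) n := by
  induction k generalizing m n with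
  | zero => rfl
  | succ k ih => rw [pow_succ, pow_succ, pow_succ, Module.End.mul_apply, par_tmul, ih]; rfl

theorem par_pow_par_pow (M : Bifact d) (k : ℕ) (m : M) : (M.par ^ k) ((M.par ^ k) m) = m := by
  have : M.par * M.par = 1 := LinearMap.ext M.par_par
  rw [← Module.End.mul_apply, ← pow_add, ← two_mul, pow_mul, pow_two, this, one_pow]
  rfl

theorem chg_par_pow (M : Bifact d) (k : ℕ) (m : M) :
    M.chg ((M.par ^ k) m) = (M.par ^ k) (M.chg m) := by
  induction k generalizing m with
  | zero => rfl
  | succ k ih => rw [pow_succ, Module.End.mul_apply, ih, M.chg_par]; rfl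

theorem map_par_pow {M N : Bifact d} (f : cycles M N) (k : ℕ) (m : M) :
    f.1 ((M.par ^ k) m) = (N.par ^ k) (f.1 m) := by
  induction k generalizing m with
  | zero => rfl
  | succ k ih => rw [pow_succ, pow_succ, Module.End.mul_apply, ih, f.2.2.2.1]; rfl

theorem par_pow_el (S : Finset (ZMod d)) (k : ℕ) (f g : Poly) :
    ((permFact S).par ^ k) (el S f g) = el S f ((-1 : ℂ) ^ k • g) := by
  induction k generalizing f g with
  | zero => simp
  | succ k ih => rw [pow_succ, Module.End.mul_apply, par_el, ih, pow_succ]; simp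

/-- The sign depends only on the parity of `a`, so a natural power of the parity operator can stand
in for an integer one. -/
theorem exp_int_pi (a : ℤ) : Complex.exp (Real.pi * Complex.I * a) = (-1) ^ a.natAbs := by
  rw [mul_comm, Complex.exp_int_mul, Complex.exp_pi_mul_I]
  obtain ⟨n, rfl | rfl⟩ := Int.eq_nat_or_neg a
  · simp
  · rw [zpow_neg, zpow_natCast, Int.natAbs_neg, Int.natAbs_natCast, ← inv_pow]
    norm_num

/-- The chain map `P_S → _{-a} (P_S)_a`, followed by a power of the parity operator, acts by a
scalar on the part of charge `q`. -/
theorem selfTwist_actsByCharge (a : ℤ) (S : Finset (ZMod d))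
    (p : cycles (permFact S) (twist (-(a : ZMod d)) (- -(a : ZMod d)) (permFact S)))
    (hp : ∀ f g, p.1 (el S f g) = toTwist _ _ _ (el S (scale (etaPow (- -(a : ZMod d)))
      (etaPow (- -(a : ZMod d))) f) (etaPow (-((S.card : ZMod d) * -(a : ZMod d))) •
        scale (etaPow (- -(a : ZMod d))) (etaPow (- -(a : ZMod d))) g))) :
    ActsByCharge (permFact S) (ofTwist _ _ _ ∘ₗ p.1 ∘ₗ (permFact S).par ^ a.natAbs)
      (fun q => Complex.exp (Real.pi * Complex.I * a * (q + (S.card - 1) / d))) := by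
  have hd : (d : ℂ) ≠ 0 := NeZero.ne _
  -- A polynomial of degree `n` contributes `2n/d` to the charge, so `η^{an}` is `exp(πia)` raised
  -- to that contribution.
  have heta : ∀ n : ℕ, etaPow (- -(a : ZMod d)) ^ n =
      Complex.exp (Real.pi * Complex.I * a * (2 / d * n)) := by
    intro n
    rw [neg_neg, etaPow_eq, ← Complex.exp_int_mul, ← Complex.exp_nat_mul]
    congr 1
    field_simp
  have heta' : etaPow (-((S.card : ZMod d) * -(a : ZMod d))) =
      Complex.exp (Real.pi * Complex.I * a * (2 / d * S.card)) := by
    rw [← heta, ← AddChar.map_nsmul_eq_pow]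
    simp
  refine actsByCharge_of_iSup (eq_top_iff.2 ?_)
  rintro t -
  obtain ⟨f, g, rfl⟩ := exists_el _ t
  rw [el_add]
  refine add_mem ?_ ?_
  · induction f using MvPolynomial.induction_on' with
    | add f f' hf hf' => simpa [add_el] using add_mem hf hf'
    | monomial u c =>
      refine Submodule.mem_iSup_of_mem
        ((2 / d : ℂ) * ((u 0 + u 1 : ℕ) : ℂ) + ((1 - S.card) / d : ℂ)) ⟨Module.End.mem_eigenspace_iff.2 ?_,
          Module.End.mem_eigenspace_iff.2 ?_⟩
      · simp [euler_monomial, add_smul, mul_smul, smul_el]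
        simp [add_el]
      · simp only [LinearMap.comp_apply, par_pow_el, hp, scale_monomial, ofTwist_toTwist, smul_el,
          heta, map_zero, smul_zero]
        congr 4
        field_simp
        ring
  · induction g using MvPolynomial.induction_on' with
    | add f f' hf hf' => simpa [add_el] using add_mem hf hf'
    | monomial u c =>
      refine Submodule.mem_iSup_of_mem
        ((2 / d : ℂ) * ((u 0 + u 1 : ℕ) : ℂ) + ((S.card + 1) / d - 1 : ℂ)) ⟨Module.End.mem_eigenspace_iff.2 ?_,
          Module.End.mem_eigenspace_iff.2 ?_⟩
      · simp [euler_monomial, add_smul, mul_smul, smul_el]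
        simp [add_el]
      · simp only [LinearMap.comp_apply, par_pow_el, hp, scale_monomial, ofTwist_toTwist, smul_el,
          heta, heta', map_zero, smul_zero, map_smul, smul_smul, ← exp_int_pi, ← Complex.exp_add]
        congr 2
        rw [Complex.exp_eq_exp_iff_exists_int]
        -- On the odd part the shift by `-1` in the charge contributes `-πia` to the exponent, while
        -- the power of the parity operator contributes `+πia`; the difference is `a` times `2πi`.
        refine ⟨a, ?_⟩
        field_simp
        ring

end

/-! ### Comparison of the two diagrams -/

section

variable {d : ℕ} [NeZero d]

theorem conjL_comp (a : ZMod d) (S : Finset (ZMod d)) :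
    conjL a S ≫ (psiL a (S := S) (T := shiftSet S a) rfl ⊙ₘ 𝟙 (line (-a))) ≫
      psiR (-a) (S := shiftSet S a) (T := S) (shiftSet_neg S a) = 𝟙 (permFact S) := by
  rw [conjL, Category.assoc, ← Category.assoc (_ ⊙ₘ _), tensorHom_comp, IsIso.inv_hom_id,
    Category.comp_id, tensorHom_id, Category.id_comp, IsIso.inv_hom_id]

theorem conjR_comp (a : ZMod d) (S : Finset (ZMod d)) :
    conjR a S ≫ (𝟙 (line a) ⊙ₘ psiR (-a) (S := S) (T := shiftSet S (-a)) rfl) ≫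
      psiL a (S := shiftSet S (-a)) (T := S) (shiftSet_neg' S a) = 𝟙 (permFact S) := by
  rw [conjR, Category.assoc, ← Category.assoc (_ ⊙ₘ _), tensorHom_comp, IsIso.inv_hom_id,
    Category.comp_id, tensorHom_id, Category.id_comp, IsIso.inv_hom_id]

/-- A bilinear `φ` commutes with letting the lines act from the left and the right, so it slides
past the absorption. What is left of `κ^L` is `s_{-a,a}`. -/
theorem conjOutside_comp_conjTwist (a : ZMod d) {S S' S'' : Finset (ZMod d)}
    (f : cycles (permFact S) (permFact S' ⊙ permFact S'')) :
    conjOutside a (homMk f) ≫ conjTwist a (permFact S') (permFact S'') =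
      (selfTwist a S).hom ≫ homMk (twistCycle (-a) (- -a) f) := by
  obtain ⟨p, hp, hp'⟩ := exists_psiL_psiR a S
  obtain ⟨e, he, he'⟩ := exists_conjTwist a (permFact S') (permFact S'')
  have key : ((𝟙 (line a) ⊙ₘ homMk f) ⊙ₘ 𝟙 (line (-a))) ≫
      conjTwist a (permFact S') (permFact S'') = homMk p ≫ homMk (twistCycle (-a) (- -a) f) := by
    rw [he, homMk_id, homMk_id, homMk_tensor, homMk_tensor, homMk_comp, homMk_comp]
    refine homMk_congr fun t => ?_
    -- The value of `φ` need not be a pure tensor, so the formula for `conjTwist` is first rewritten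
    -- through the two outer actions on the whole product.
    have hE : ∀ u u' v v' (t : (permFact S' ⊙ permFact S'' : Bifact d)),
        e.1 ((el {a} u u' ⊗ₚ t) ⊗ₚ el {-a} v v') = toTwist (-a) (- -a) _
          (Polynomial.aeval (permFact S' ⊙ permFact S'').xr (lineEvalR (-a) v)
            (Polynomial.aeval (permFact S' ⊙ permFact S'').xl (lineEvalL a u) t)) := by
      intro u u' v v' t
      induction t using tensor_induction with
      | add s t hs ht => simp only [tmul_add, add_tmul, map_add, hs, ht]
      | tmul m n =>
        have e1 := aeval_comm ((tmulL (permFact S') (permFact S'')).flip n) (permFact S').xl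
          (permFact S' ⊙ permFact S'').xl (fun m => by simp) (lineEvalL a u) m
        have e2 := aeval_comm (tmulL (permFact S') (permFact S'')
          (Polynomial.aeval (permFact S').xl (lineEvalL a u) m)) (permFact S'').xr
          (permFact S' ⊙ permFact S'').xr (fun m => by simp) (lineEvalR (-a) v) n
        simp only [LinearMap.flip_apply, tmulL_apply] at e1 e2
        rw [he', ← e1, ← e2]
    induction t using tensor_induction with
    | add s t hs ht => simp only [map_add, hs, ht]
    | tmul t v => induction t using tensor_induction with
      | add s t hs ht => simp only [add_tmul, map_add, hs, ht]
      | tmul u m =>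
        obtain ⟨u, u', rfl⟩ := exists_el _ u
        obtain ⟨v, v', rfl⟩ := exists_el _ v
        simp only [cyclesComp_apply, cyclesTensor_tmul, cyclesId_apply, hE, hp',
          twistCycle_toTwist, aeval_comm f.1 _ _ f.2.1, aeval_comm f.1 _ _ f.2.2.1]
  rw [conjOutside, Category.assoc, key, ← hp]
  have := conjL_comp a S
  simp only [← Category.assoc] at this ⊢
  rw [this, Category.id_comp]

/-- The cap makes the inner lines act on the second leg in the middle variable. In the twisted legs
the inner `-a` acts on the first from the right and the inner `a` on the second from the left, which
is the same thing in a tensor product over that variable. -/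
theorem conjLegs_comp_conjTwist (a : ZMod d) {S S' S'' : Finset (ZMod d)}
    (φ : permFact S ⟶ permFact S' ⊙ permFact S'') :
    conjLegs a φ ≫ conjTwist a (permFact S') (permFact S'') =
      φ ≫ ((selfTwist a S').hom ⊙ₘ (selfTwist a S'').hom) ≫
        (twistTensor (-a) (- -a) (-a) (- -a) (by simp) (permFact S') (permFact S'')).hom := by
  obtain ⟨p, hp, hp'⟩ := exists_psiL_psiR a S'
  obtain ⟨q, hq, hq'⟩ := exists_psiR_psiL a S''
  obtain ⟨e, he, he'⟩ := exists_conjTwist a (permFact S') (permFact S'')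
  obtain ⟨c, hc, hc'⟩ := exists_cap a (permFact S') (permFact S'')
  obtain ⟨t, ht, ht'⟩ := exists_twistTensor (-a) (- -a) (-a) (- -a) (by simp)
    (permFact S') (permFact S'')
  have key : cap a (permFact S') (permFact S'') ≫ conjTwist a (permFact S') (permFact S'') =
      (homMk p ⊙ₘ homMk q) ≫ (twistTensor (-a) (- -a) (-a) (- -a) (by simp)
        (permFact S') (permFact S'')).hom := by
    rw [hc, he, ht, homMk_tensor, homMk_comp, homMk_comp]
    refine homMk_congr fun s => ?_
    induction s using tensor_induction with
    | add s t hs ht => simp only [map_add, hs, ht]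
    | tmul s s' =>
    induction s using tensor_induction with
    | add s t hs ht => simp only [add_tmul, map_add, hs, ht]
    | tmul s v =>
    induction s using tensor_induction with
    | add s t hs ht => simp only [add_tmul, map_add, hs, ht]
    | tmul u m =>
    induction s' using tensor_induction with
    | add s t hs ht => simp only [tmul_add, map_add, hs, ht]
    | tmul u' s =>
    induction s using tensor_induction with
    | add s t hs ht => simp only [tmul_add, map_add, hs, ht]
    | tmul n v' =>
    obtain ⟨u, w, rfl⟩ := exists_el _ u
    obtain ⟨v, x, rfl⟩ := exists_el _ v
    obtain ⟨u', w', rfl⟩ := exists_el _ u'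
    obtain ⟨v', x', rfl⟩ := exists_el _ v'
    simp only [cyclesComp_apply, cyclesTensor_tmul, hc', he', hp', hq', ht', aeval_xr_tmul]
    have comm (P Q : Polynomial ℂ) (n : permFact S'') :
        Polynomial.aeval (permFact S'').xl P (Polynomial.aeval (permFact S'').xr Q n) =
          Polynomial.aeval (permFact S'').xr Q (Polynomial.aeval (permFact S'').xl P n) :=
      aeval_comm (Polynomial.aeval (permFact S'').xl P) (permFact S'').xr (permFact S'').xr
        (fun n => (aeval_comm (permFact S'').xr (permFact S'').xl (permFact S'').xl
          (fun n => ((permFact S'').xl_xr n).symm) P n).symm) Q n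
    rw [map_mul, Module.End.mul_apply, comm, comm]
  rw [conjLegs, Category.assoc, Category.assoc, key, ← hp, ← hq, ← Category.assoc (_ ⊙ₘ _),
    tensorHom_comp]
  have h1 := conjL_comp a S'
  have h2 := conjR_comp a S''
  simp only [← Category.assoc] at h1 h2 ⊢
  rw [h1, h2, Category.id_comp, Category.id_comp]

/-- The bound on `l` prevents the interval from wrapping around `ℤ/d`; it enters the argument only
here. -/
theorem card_interval (m : ZMod d) {l : ℕ} (hl : l + 2 ≤ d) : (interval m l).card = l + 1 := by
  rw [interval, Finset.card_image_of_injOn, Finset.card_range]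
  intro i hi j hj h
  have hi' : i < d := by have := Finset.mem_range.1 hi; omega
  have hj' : j < d := by have := Finset.mem_range.1 hj; omega
  have := (ZMod.natCast_eq_natCast_iff' i j d).1 (add_left_cancel h)
  rwa [Nat.mod_eq_of_lt hi', Nat.mod_eq_of_lt hj'] at this

theorem selfTwist_comp_twistCycle (a : ℤ) {S S' S'' : Finset (ZMod d)}
    (f : cycles (permFact S) (permFact S' ⊙ permFact S'')) :
    (selfTwist (a : ZMod d) S).hom ≫ homMk (twistCycle (-(a : ZMod d)) (- -(a : ZMod d)) f) =
      Complex.exp (Real.pi * Complex.I * a *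
        (((S.card - 1) - (S'.card - 1) - (S''.card - 1)) / d)) •
        (homMk f ≫ ((selfTwist (a : ZMod d) S').hom ⊙ₘ (selfTwist (a : ZMod d) S'').hom) ≫
          (twistTensor (-(a : ZMod d)) (- -(a : ZMod d)) (-(a : ZMod d)) (- -(a : ZMod d))
            (by simp) (permFact S') (permFact S'')).hom) := by
  obtain ⟨s, hs, hs'⟩ := exists_untwist (-(a : ZMod d)) (- -(a : ZMod d)) (S := S) (T := S)
    (by simp [shiftSet])
  obtain ⟨p, hp, hp'⟩ := exists_untwist (-(a : ZMod d)) (- -(a : ZMod d)) (S := S') (T := S')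
    (by simp [shiftSet])
  obtain ⟨q, hq, hq'⟩ := exists_untwist (-(a : ZMod d)) (- -(a : ZMod d)) (S := S'') (T := S'')
    (by simp [shiftSet])
  obtain ⟨t, ht, ht'⟩ := exists_twistTensor (-(a : ZMod d)) (- -(a : ZMod d)) (-(a : ZMod d))
    (- -(a : ZMod d)) (by simp) (permFact S') (permFact S'')
  have Hs := selfTwist_actsByCharge a S s hs'
  have Hp := selfTwist_actsByCharge a S' p hp'
  have Hq := selfTwist_actsByCharge a S'' q hq'
  -- The exponent is affine in the charge, so on a tensor product the charges add up, and so do the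
  -- constants `(|S'|-1)/d` and `(|S''|-1)/d`.
  have Ht := Hp.tensor Hq (g'' := fun x => Complex.exp (Real.pi * Complex.I * a *
      (x + ((S'.card - 1) + (S''.card - 1)) / d)))
    (fun x y => by rw [← Complex.exp_add]; congr 1; ring)
    (ofTwist _ _ _ ∘ₗ t.1 ∘ₗ (cyclesTensor p q).1 ∘ₗ
      (permFact S' ⊙ permFact S'').par ^ a.natAbs) (fun m n => by
      obtain ⟨m', hm⟩ := exists_toTwist _ _ _ (p.1 (((permFact S').par ^ a.natAbs) m))
      obtain ⟨n', hn⟩ := exists_toTwist _ _ _ (q.1 (((permFact S'').par ^ a.natAbs) n))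
      simp only [LinearMap.comp_apply, par_pow_tmul, cyclesTensor_tmul, hm, hn, ht',
        ofTwist_toTwist])
  simp only [selfTwist]
  rw [hs, hp, hq, ht, homMk_tensor, homMk_comp, homMk_comp, homMk_comp, smul_homMk]
  refine homMk_congr fun m => ?_
  have hm : m ∈ ⨆ q : ℂ, (permFact S).chg.eigenspace q := by
    rw [(permFact S).chg_diagonalisable]; trivial
  induction hm using Submodule.iSup_induction' with
  | zero => rw [map_zero, map_zero]
  | add a b _ _ ha hb => rw [map_add, map_add, ha, hb]
  | mem x m hm =>
    rw [Module.End.mem_eigenspace_iff] at hm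
    -- The scalar formulas include a power of the parity operator. Applying them to `n`, from which
    -- that power returns `m`, and using that `f` commutes with parity removes it from both sides.
    obtain ⟨n, hn⟩ : ∃ n, n = ((permFact S).par ^ a.natAbs) m := ⟨_, rfl⟩
    have hmn : ((permFact S).par ^ a.natAbs) n = m := by rw [hn, par_pow_par_pow]
    have hn' : (permFact S).chg n = x • n := by rw [hn, chg_par_pow, hm, map_smul]
    have e1 := Hs x n hn'
    have e2 := Ht x (f.1 n) (by rw [← f.2.2.2.2.1, hn', map_smul])
    simp only [LinearMap.comp_apply] at e1 e2
    rw [hmn] at e1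
    rw [← map_par_pow, hmn] at e2
    have e3 := congrArg (toTwist (-(a : ZMod d)) (- -(a : ZMod d)) _) e1
    have e4 := congrArg (toTwist (-(a : ZMod d)) (- -(a : ZMod d)) _) e2
    rw [toTwist_ofTwist] at e3 e4
    have e5 : (Complex.exp (Real.pi * Complex.I * a *
        (((S.card - 1) - (S'.card - 1) - (S''.card - 1)) / d)) •
          cyclesComp f (cyclesComp (cyclesTensor p q) t)).1 m =
        Complex.exp (Real.pi * Complex.I * a *
        (((S.card - 1) - (S'.card - 1) - (S''.card - 1)) / d)) •
          t.1 ((cyclesTensor p q).1 (f.1 m)) := rfl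
    rw [e5, e4, cyclesComp_apply, e3, twistCycle_toTwist, map_smul, map_smul, map_smul, smul_smul,
      ← Complex.exp_add]
    congr 2
    ring

end

end

end LandauGinzburg

theorem proposition3 (d : ℕ) [NeZero d] (hd : 2 ≤ d) :
    ∃ (_ : ∀ (a : ZMod d) (S T : Finset (ZMod d)) (h : T = shiftSet S a), IsIso (psiL a h))
      (_ : ∀ (a : ZMod d) (S T : Finset (ZMod d)) (h : T = shiftSet S a), IsIso (psiR a h)),
      ∀ (a : ℤ) (m m' m'' : ZMod d) (l l' l'' : ℕ), l + 2 ≤ d → l' + 2 ≤ d → l'' + 2 ≤ d →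
        ∀ φ : permInterval m l ⟶ permInterval m' l' ⊙ permInterval m'' l'',
          conjOutside (a : ZMod d) φ =
            Complex.exp (2 * Real.pi * Complex.I / d *
              ((a : ℂ) / 2 * ((l : ℂ) - (l' : ℂ) - (l'' : ℂ)))) •
              conjLegs (a : ZMod d) φ := by
  refine ⟨fun a S T h => isIso_psiL a h, fun a S T h => isIso_psiR a h, ?_⟩
  intro a m m' m'' l l' l'' hl hl' hl'' φ
  obtain ⟨f, rfl⟩ := exists_homMk φ
  -- Only the invertibility of `conjTwist` is used to return from the twisted bimodules to the
  -- original target. Afterwards the two scalars agree because `|S| - 1 = l` for each interval.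
  rw [← cancel_mono (conjTwist (a : ZMod d) (permInterval m' l') (permInterval m'' l'')),
    smul_comp_eq, conjOutside_comp_conjTwist, conjLegs_comp_conjTwist, selfTwist_comp_twistCycle,
    card_interval m hl, card_interval m' hl', card_interval m'' hl'']
  congr 2
  push_cast
  ring
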